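/- Let $r_0\ge 0$, $p_0>0$, $r_0+p_0\le 1$, $p,q>0$, $p+q=1$, and let $P=(P_{ij})_{i,j\ge 0}$ be the tridiagonal (sub)stochastic matrix with $P_{00}=r_0$, $P_{01}=p_0$ and, for $i\ge 1$, $P_{i,i-1}=q$, $P_{i,i+1}=p$, all other entries being $0$. Let $Q_0,Q_1,\dots$ be the polynomials with $Q_0=1$ and $\sum_k P_{jk}Q_k(x)=xQ_j(x)$ for all $j\ge 0$, and let $\pi_0=1$, $\pi_j=p_0p^{j-1}/q^j$ for $j\ge1$. There is a unique finite Borel measure $\psi$ carried by $[-1,1]$ with $\pi_j\int Q_iQ_j\,d\psi=\delta_{ij}$ for all $i,j\ge 0$ (the spectral measure). Let $\eta$ be the supremum of the support of $\psi$, and write $P^n_{ij}$ for the $(i,j)$ entry of $P^n$. Then the following hold for all $i,j,k,l\ge 0$. (a) If $r_0\ne 0$ and $\psi$ has at least one point mass of nonzero weight, then $P^n_{kl}\neq 0$ for all large $n$, $Q_k(\eta)Q_l(\eta)\ne 0$, and $$\lim_{n\to\infty}\frac{P^n_{ij}}{P^n_{kl}}=\frac{\pi_j}{\pi_l}\,\frac{Q_i(\eta)Q_j(\eta)}{Q_k(\eta)Q_l(\eta)}.$$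 (b) If $r_0\neq 0$ (with or without point masses), then $P^n_{kl}\ne 0$ for all large $n$, and the limits of $P^n_{ij}/P^n_{kl}$ along even $n$ and along odd $n$ exist and are finite. (c) If $r_0=0$, then $P^n_{kl}=0$ whenever $n\not\equiv k+l \pmod 2$, while $P^n_{kl}\neq0$ for all large $n\equiv k+l\pmod 2$. Moreover $Q_k(\eta)Q_l(\eta)\ne 0$, and the limit of $P^n_{ij}/P^n_{kl}$ along $n\equiv k+l\pmod 2$ exists; it equals the right-hand side of (a) if $i+j\equiv k+l\pmod 2$ and equals $0$ otherwise. -/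

import Mathlib

open MeasureTheory Filter Topology

/-- The one-step transition matrix on the states `0, 1, 2, …`: row `0` is `(r₀, p₀, 0, …)`, and
row `i ≥ 1` has `q` in column `i - 1`, `p` in column `i + 1` and `0` elsewhere. -/
noncomputable def walkMatrix (r₀ p₀ p q : ℝ) : Matrix ℕ ℕ ℝ := fun i j =>
  if j = i + 1 then (if i = 0 then p₀ else p)
  else if i = j + 1 then q
  else if i = 0 ∧ j = 0 then r₀
  else 0

theorem walkMatrix_eq_zero (r₀ p₀ p q : ℝ) {i k : ℕ} (h : i + 2 ≤ k) :
    walkMatrix r₀ p₀ p q i k = 0 := by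
  unfold walkMatrix
  split_ifs <;> first | rfl | omega

/-- The `n`-th power of the transition matrix. The product of row `i` with a column is a sum over
all states `k`, and the terms with `k ≥ i + 2` vanish by `walkMatrix_eq_zero`. -/
noncomputable def walkPow (r₀ p₀ p q : ℝ) : ℕ → Matrix ℕ ℕ ℝ
  | 0 => 1
  | n + 1 => fun i j =>
      ∑ k ∈ Finset.range (i + 2), walkMatrix r₀ p₀ p q i k * walkPow r₀ p₀ p q n k j

/-- The polynomials `Q_j` determined by `Q_0 = 1` and `P Q(x) = x Q(x)`, that is,
`r₀ Q_0 + p₀ Q_1 = x Q_0` and `q Q_j + p Q_{j+2} = x Q_{j+1}`. -/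
noncomputable def walkPoly (r₀ p₀ p q : ℝ) : ℕ → ℝ → ℝ
  | 0, _ => 1
  | 1, x => (x - r₀) / p₀
  | j + 2, x => (x * walkPoly r₀ p₀ p q (j + 1) x - q * walkPoly r₀ p₀ p q j x) / p

/-- The constants `π_0 = 1`, `π_j = p₀ p^(j-1) / q^j` for `j ≥ 1`. -/
noncomputable def walkWeight (p₀ p q : ℝ) : ℕ → ℝ
  | 0 => 1
  | j + 1 => p₀ * p ^ j / q ^ (j + 1)

/-- `ψ` is the spectral (orthogonality) measure of the walk: a finite Borel measure carried by
`[-1, 1]` with `π_j ∫ Q_i Q_j dψ = δ_{ij}`. -/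
structure IsSpectralMeasure (r₀ p₀ p q : ℝ) (ψ : Measure ℝ) : Prop where
  finite : IsFiniteMeasure ψ
  carried : ψ (Set.Icc (-1) 1)ᶜ = 0
  orthogonal : ∀ i j : ℕ,
    walkWeight p₀ p q j * ∫ x, walkPoly r₀ p₀ p q i x * walkPoly r₀ p₀ p q j x ∂ψ
      = if i = j then 1 else 0

/-- `η`, the supremum of the points in the support of `ψ`. -/
noncomputable def supportTop (ψ : Measure ℝ) : ℝ := sSup ψ.support

/-- The value `(π_j / π_l) · Q_i(x) Q_j(x) / (Q_k(x) Q_l(x))`. -/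
noncomputable def ratioValue (r₀ p₀ p q : ℝ) (i j k l : ℕ) (x : ℝ) : ℝ :=
  walkWeight p₀ p q j / walkWeight p₀ p q l *
    (walkPoly r₀ p₀ p q i x * walkPoly r₀ p₀ p q j x /
      (walkPoly r₀ p₀ p q k x * walkPoly r₀ p₀ p q l x))

/-! By the Karlin–McGregor formula (`walkPow_eq`), `P^n_{ij} = π_j ∫ x^n Q_i Q_j dψ`. The moments
`μ_n = ∫ x^n dψ = P^n_{00}` are nonnegative; for odd `n` this forces `ψ` to live on `[-η, η]`, so
`x^(2m) dψ`, normalised, concentrates at `±η`. Up to a function vanishing at `±η`, a continuous `h`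
is of the form `a + b x`. Hence all limits follow once `μ_{2m+1} / μ_{2m}` converges to some `L`.
Denominators stay away from zero because suitable paths give `P^{2m+e}_{kl} ≥ c P^{2m}_{00}` with `c
> 0`.

To find `L`, put `G(w) = (p - p₀) w² - r₀ w + q`. If `r₀ = 0`, odd moments vanish and `L = 0`. An
atom `x` makes `π_j Q_j(x)²` summable, which forces `Q_j(x) = w^j` with `G(w) = 0` and `p w² < q`;
such a root can be taken positive. For `r₀ > 0`, a positive root gives a positive square summable
eigenvector, hence an atom at `η` and none at `-η`, and `L = η`. Without such a root, a quadratic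
`D` with `∫ x^(2m+1) D dψ = 0` yields a linear equation for `L`; it degenerates only if `p₀ = 2p`,
when `G` does have such a root.

Existence of `ψ` comes from weak limits of Gauss quadratures, uniqueness from the moments and
Weierstrass approximation. -/

/-! ### Transition matrix, weights and polynomials. -/

theorem walkMatrix_succ_self (r₀ p₀ p q : ℝ) (i : ℕ) : walkMatrix r₀ p₀ p q (i + 1) i = q := by
  rw [walkMatrix, if_neg (by omega), if_pos rfl]

theorem walkMatrix_self_succ_succ (r₀ p₀ p q : ℝ) (i : ℕ) :
    walkMatrix r₀ p₀ p q (i + 1) (i + 2) = p := by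
  rw [walkMatrix, if_pos rfl, if_neg (by omega)]

theorem walkMatrix_zero_sum (r₀ p₀ p q : ℝ) (g : ℕ → ℝ) {M : ℕ} (hM : 2 ≤ M) :
    ∑ k ∈ Finset.range M, walkMatrix r₀ p₀ p q 0 k * g k = r₀ * g 0 + p₀ * g 1 := by
  rw [← Finset.sum_subset (Finset.range_mono hM)]
  · simp [Finset.sum_range_succ, walkMatrix]
  · intro k _ hk
    rw [walkMatrix_eq_zero _ _ _ _ (not_lt.1 fun h => hk (Finset.mem_range.2 h)), zero_mul]

theorem walkMatrix_succ_sum (r₀ p₀ p q : ℝ) (g : ℕ → ℝ) {i M : ℕ} (hM : i + 3 ≤ M) :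
    ∑ k ∈ Finset.range M, walkMatrix r₀ p₀ p q (i + 1) k * g k = q * g i + p * g (i + 2) := by
  rw [← Finset.sum_subset (Finset.range_mono hM)]
  · rw [Finset.sum_range_succ, Finset.sum_range_succ, Finset.sum_range_succ,
      Finset.sum_eq_zero]
    · have h : walkMatrix r₀ p₀ p q (i + 1) (i + 1) = 0 := by
        rw [walkMatrix, if_neg (by omega), if_neg (by omega), if_neg (by omega)]
      rw [h, walkMatrix_succ_self, walkMatrix_self_succ_succ]
      ring
    · intro k hk
      have := Finset.mem_range.1 hk
      have : walkMatrix r₀ p₀ p q (i + 1) k = 0 := by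
        unfold walkMatrix
        rw [if_neg (by omega), if_neg (by omega), if_neg (by omega)]
      rw [this, zero_mul]
  · intro k _ hk
    rw [walkMatrix_eq_zero _ _ _ _ (not_lt.1 fun h => hk (Finset.mem_range.2 h)), zero_mul]

theorem walkMatrix_nonneg {r₀ p₀ p q : ℝ} (hr₀ : 0 ≤ r₀) (hp₀ : 0 ≤ p₀) (hp : 0 ≤ p) (hq : 0 ≤ q)
    (i j : ℕ) : 0 ≤ walkMatrix r₀ p₀ p q i j := by
  unfold walkMatrix
  split_ifs <;> first | assumption | rfl

theorem walkMatrix_sum_le_one {r₀ p₀ p q : ℝ} (hr₀ : 0 ≤ r₀) (hp₀ : 0 ≤ p₀) (hp : 0 ≤ p)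
    (hq : 0 ≤ q) (hsum : r₀ + p₀ ≤ 1) (hpq : p + q = 1) (i M : ℕ) :
    ∑ k ∈ Finset.range M, walkMatrix r₀ p₀ p q i k ≤ 1 := by
  have h1 : ∑ k ∈ Finset.range M, walkMatrix r₀ p₀ p q i k
      ≤ ∑ k ∈ Finset.range (M + (i + 2)), walkMatrix r₀ p₀ p q i k * 1 := by
    simp only [mul_one]
    exact Finset.sum_le_sum_of_subset_of_nonneg (Finset.range_mono (by omega))
      fun k _ _ => walkMatrix_nonneg hr₀ hp₀ hp hq i k
  refine h1.trans ?_
  cases i with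
  | zero => rw [walkMatrix_zero_sum _ _ _ _ (fun _ => 1) (by omega)]; linarith
  | succ i => rw [walkMatrix_succ_sum _ _ _ _ (fun _ => 1) (by omega)]; linarith

theorem walkWeight_pos {p₀ p q : ℝ} (hp₀ : 0 < p₀) (hp : 0 < p) (hq : 0 < q) (j : ℕ) :
    0 < walkWeight p₀ p q j := by
  cases j <;> simp only [walkWeight] <;> positivity

theorem walkWeight_succ_succ {p₀ p q : ℝ} (hq : q ≠ 0) (j : ℕ) :
    q * walkWeight p₀ p q (j + 2) = p * walkWeight p₀ p q (j + 1) := by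
  simp only [walkWeight]
  field_simp
  ring

/-- Reversibility of the walk with respect to the weights. -/
theorem walkWeight_mul_walkMatrix {r₀ p₀ p q : ℝ} (hq : q ≠ 0) (i j : ℕ) :
    walkWeight p₀ p q i * walkMatrix r₀ p₀ p q i j
      = walkWeight p₀ p q j * walkMatrix r₀ p₀ p q j i := by
  have key : ∀ i, walkWeight p₀ p q i * walkMatrix r₀ p₀ p q i (i + 1)
      = walkWeight p₀ p q (i + 1) * walkMatrix r₀ p₀ p q (i + 1) i := by
    intro i
    rw [walkMatrix_succ_self]
    cases i with
    | zero => simp [walkMatrix, walkWeight, hq]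
    | succ i =>
      rw [walkMatrix_self_succ_succ, mul_comm _ q, walkWeight_succ_succ hq, mul_comm]
  by_cases h1 : j = i + 1
  · subst h1; exact key i
  by_cases h2 : i = j + 1
  · subst h2; exact (key j).symm
  by_cases h3 : i = j
  · subst h3; rfl
  have h4 : walkMatrix r₀ p₀ p q i j = 0 := by
    unfold walkMatrix
    rw [if_neg h1, if_neg h2, if_neg (by omega)]
  have h5 : walkMatrix r₀ p₀ p q j i = 0 := by
    unfold walkMatrix
    rw [if_neg h2, if_neg h1, if_neg (by omega)]
  rw [h4, h5, mul_zero, mul_zero]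

theorem walkPoly_zero_row {r₀ p₀ p q : ℝ} (hp₀ : p₀ ≠ 0) (x : ℝ) :
    r₀ * walkPoly r₀ p₀ p q 0 x + p₀ * walkPoly r₀ p₀ p q 1 x = x * walkPoly r₀ p₀ p q 0 x := by
  simp only [walkPoly]
  field_simp
  ring

theorem walkPoly_succ_row {r₀ p₀ p q : ℝ} (hp : p ≠ 0) (x : ℝ) (j : ℕ) :
    q * walkPoly r₀ p₀ p q j x + p * walkPoly r₀ p₀ p q (j + 2) x
      = x * walkPoly r₀ p₀ p q (j + 1) x := by
  rw [walkPoly]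
  field_simp
  ring

theorem walkMatrix_sum_walkPoly {r₀ p₀ p q : ℝ} (hp₀ : p₀ ≠ 0) (hp : p ≠ 0) (x : ℝ) (i : ℕ) :
    ∑ k ∈ Finset.range (i + 2), walkMatrix r₀ p₀ p q i k * walkPoly r₀ p₀ p q k x
      = x * walkPoly r₀ p₀ p q i x := by
  cases i with
  | zero => rw [walkMatrix_zero_sum _ _ _ _ _ le_rfl, walkPoly_zero_row hp₀]
  | succ i => rw [walkMatrix_succ_sum _ _ _ _ _ le_rfl, walkPoly_succ_row hp]

theorem continuous_walkPoly (r₀ p₀ p q : ℝ) : ∀ j, Continuous (walkPoly r₀ p₀ p q j)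
  | 0 => by simpa only [funext (walkPoly.eq_1 r₀ p₀ p q)] using continuous_const
  | 1 => by
    rw [funext (walkPoly.eq_2 r₀ p₀ p q)]
    fun_prop
  | j + 2 => by
    have h1 := continuous_walkPoly r₀ p₀ p q (j + 1)
    have h2 := continuous_walkPoly r₀ p₀ p q j
    rw [funext (walkPoly.eq_3 r₀ p₀ p q · j)]
    fun_prop

/-- A sequence satisfying the first rows of the eigenvalue equation is a multiple of the
polynomial sequence. -/
theorem eq_mul_walkPoly_of_row_eq {r₀ p₀ p q : ℝ} (hp₀ : p₀ ≠ 0) (hp : p ≠ 0) {x : ℝ}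
    {w : ℕ → ℝ} {N : ℕ}
    (h0 : 0 < N → r₀ * w 0 + p₀ * w 1 = x * w 0)
    (h : ∀ i, i + 1 < N → q * w i + p * w (i + 2) = x * w (i + 1)) :
    ∀ j ≤ N, w j = w 0 * walkPoly r₀ p₀ p q j x
  | 0, _ => by simp [walkPoly]
  | 1, hj => by
    have := h0 (by omega)
    simp only [walkPoly]
    field_simp
    linarith
  | j + 2, hj => by
    have h1 := eq_mul_walkPoly_of_row_eq hp₀ hp h0 h (j + 1) (by omega)
    have h2 := eq_mul_walkPoly_of_row_eq hp₀ hp h0 h j (by omega)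
    have h3 := h j (by omega)
    rw [h1, h2] at h3
    simp only [walkPoly]
    field_simp
    linarith

/-! ### Existence of the spectral measure. -/

/-- Maximum principle: compare both sides in a row where `|w i|` is maximal, using that row sums are
at most one. -/
theorem abs_le_one_of_row_eq {r₀ p₀ p q : ℝ} (hr₀ : 0 ≤ r₀) (hp₀ : 0 ≤ p₀) (hp : 0 ≤ p)
    (hq : 0 ≤ q) (hsum : r₀ + p₀ ≤ 1) (hpq : p + q = 1) {x : ℝ} {w : ℕ → ℝ} {M : ℕ}
    (h : ∀ i < M, ∑ k ∈ Finset.range M, walkMatrix r₀ p₀ p q i k * w k = x * w i)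
    (hw : ∃ i < M, w i ≠ 0) : |x| ≤ 1 := by
  obtain ⟨i₀, hi₀, hwi₀⟩ := hw
  obtain ⟨i, hi, hmax⟩ := Finset.exists_max_image (Finset.range M) (fun i => |w i|)
    ⟨i₀, Finset.mem_range.2 hi₀⟩
  have hpos : 0 < |w i| :=
    (abs_pos.2 hwi₀).trans_le (hmax i₀ (Finset.mem_range.2 hi₀))
  have h1 : |x| * |w i| ≤ 1 * |w i| := by
    rw [← abs_mul, ← h i (Finset.mem_range.1 hi)]
    calc |∑ k ∈ Finset.range M, walkMatrix r₀ p₀ p q i k * w k|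
        ≤ ∑ k ∈ Finset.range M, |walkMatrix r₀ p₀ p q i k * w k| :=
          Finset.abs_sum_le_sum_abs _ _
      _ ≤ ∑ k ∈ Finset.range M, walkMatrix r₀ p₀ p q i k * |w i| := by
          refine Finset.sum_le_sum fun k hk => ?_
          have h0 := walkMatrix_nonneg hr₀ hp₀ hp hq i k
          rw [abs_mul, abs_of_nonneg h0]
          exact mul_le_mul_of_nonneg_left (hmax k hk) h0
      _ ≤ 1 * |w i| := by
          rw [← Finset.sum_mul]
          exact mul_le_mul_of_nonneg_right
            (walkMatrix_sum_le_one hr₀ hp₀ hp hq hsum hpq i M) hpos.le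
  exact le_of_mul_le_mul_right h1 hpos

/-- The symmetrised truncation of the transition matrix to the states `0, …, N`. -/
noncomputable def walkJacobi (r₀ p₀ p q : ℝ) (N : ℕ) : Matrix (Fin (N + 1)) (Fin (N + 1)) ℝ :=
  fun a b => √(walkWeight p₀ p q a) * walkMatrix r₀ p₀ p q a b / √(walkWeight p₀ p q b)

theorem walkJacobi_isHermitian {r₀ p₀ p q : ℝ} (hp₀ : 0 < p₀) (hp : 0 < p) (hq : 0 < q) (N : ℕ) :
    (walkJacobi r₀ p₀ p q N).IsHermitian := by
  refine Matrix.IsHermitian.ext fun a b => ?_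
  have ha := walkWeight_pos hp₀ hp hq a
  have hb := walkWeight_pos hp₀ hp hq b
  have h := walkWeight_mul_walkMatrix (r₀ := r₀) (p₀ := p₀) (p := p) hq.ne' a b
  have h1 := Real.mul_self_sqrt ha.le
  have h2 := Real.mul_self_sqrt hb.le
  have h3 := Real.sqrt_pos.2 ha
  have h4 := Real.sqrt_pos.2 hb
  simp only [walkJacobi, star_trivial]
  rw [div_eq_div_iff h3.ne' h4.ne']
  linear_combination (-1) * h + walkMatrix r₀ p₀ p q (b : ℕ) a * h2
    - walkMatrix r₀ p₀ p q (a : ℕ) b * h1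

/-- Gauss quadrature: finitely many nodes in `[-1, 1]` with nonnegative weights for which the
polynomials up to degree `N` are orthogonal. -/
theorem exists_quadrature {r₀ p₀ p q : ℝ} (hr₀ : 0 ≤ r₀) (hp₀ : 0 < p₀) (hsum : r₀ + p₀ ≤ 1)
    (hp : 0 < p) (hq : 0 < q) (hpq : p + q = 1) (N : ℕ) :
    ∃ (x : Fin (N + 1) → Set.Icc (-1 : ℝ) 1) (c : Fin (N + 1) → ℝ), (∀ a, 0 ≤ c a) ∧
      ∀ i ≤ N, ∀ j ≤ N, walkWeight p₀ p q j *
        ∑ a, c a * (walkPoly r₀ p₀ p q i (x a) * walkPoly r₀ p₀ p q j (x a))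
          = if i = j then 1 else 0 := by
  have hJ := walkJacobi_isHermitian (r₀ := r₀) hp₀ hp hq N
  -- Eigenvectors are extended by zero so that they can be indexed by `ℕ`; dividing by `√π_n` undoes
  -- the symmetrisation.
  let v : Fin (N + 1) → ℕ → ℝ := fun a n =>
    if h : n < N + 1 then hJ.eigenvectorBasis a ⟨n, h⟩ else 0
  let w : Fin (N + 1) → ℕ → ℝ := fun a n => v a n / √(walkWeight p₀ p q n)
  have hs : ∀ n, 0 < √(walkWeight p₀ p q n) := fun n => Real.sqrt_pos.2 (walkWeight_pos hp₀ hp hq n)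
  have hv : ∀ a (i : Fin (N + 1)), v a i = hJ.eigenvectorBasis a i := by
    intro a i
    exact dif_pos i.2
  have hrow : ∀ a, ∀ i < N + 1, ∑ k ∈ Finset.range (N + 1), walkMatrix r₀ p₀ p q i k * w a k
      = hJ.eigenvalues a * w a i := by
    intro a i hi
    have h1 := congrFun (hJ.mulVec_eigenvectorBasis a) ⟨i, hi⟩
    simp only [Matrix.mulVec, dotProduct, Pi.smul_apply, smul_eq_mul] at h1
    have h2 : ∑ k : Fin (N + 1), √(walkWeight p₀ p q i) * (walkMatrix r₀ p₀ p q i k * w a k)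
        = hJ.eigenvalues a * v a i := by
      rw [show v a i = hJ.eigenvectorBasis a ⟨i, hi⟩ from hv a ⟨i, hi⟩]
      refine Eq.trans (Finset.sum_congr rfl fun k _ => ?_) h1
      simp only [w, walkJacobi, hv]
      ring
    rw [← Finset.mul_sum, Fin.sum_univ_eq_sum_range (fun k => walkMatrix r₀ p₀ p q i k * w a k)] at h2
    have h3 := (hs i).ne'
    rw [show v a i = √(walkWeight p₀ p q i) * w a i from (mul_div_cancel₀ _ h3).symm] at h2
    exact mul_left_cancel₀ h3 (h2.trans (by ring))
  -- The eigenvector matrix is orthogonal, so its rows are orthonormal as well as its columns.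
  have horth : ∀ i j : Fin (N + 1), ∑ a, v a i * v a j = if i = j then 1 else 0 := by
    intro i j
    have h1 := Matrix.mem_unitaryGroup_iff.1 (hJ.eigenvectorUnitary).2
    have h2 := congrFun (congrFun h1 i) j
    rw [Matrix.mul_apply, Matrix.one_apply] at h2
    simp only [Matrix.star_apply, star_trivial, Matrix.IsHermitian.eigenvectorUnitary_apply] at h2
    simpa only [hv] using h2
  -- Truncation alters only row `N`, which is not needed to determine the entries up to `N`.
  have hpoly : ∀ a, ∀ j ≤ N, w a j = w a 0 * walkPoly r₀ p₀ p q j (hJ.eigenvalues a) := by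
    intro a
    refine eq_mul_walkPoly_of_row_eq hp₀.ne' hp.ne' (fun h => ?_) (fun i h => ?_)
    · rw [← hrow a 0 (by omega), walkMatrix_zero_sum _ _ _ _ _ (by omega)]
    · rw [← hrow a (i + 1) (by omega), walkMatrix_succ_sum _ _ _ _ _ (by omega)]
  have hw0 : ∀ a, w a 0 = v a 0 := by
    intro a
    simp [w, walkWeight]
  have hbound : ∀ a, |hJ.eigenvalues a| ≤ 1 := by
    intro a
    refine abs_le_one_of_row_eq hr₀ hp₀.le hp.le hq.le hsum hpq (hrow a) ?_
    by_contra! hcon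
    have h0 : hJ.eigenvectorBasis a = 0 := by
      ext i
      have h1 := hcon i i.2
      rw [← hv]
      simpa [w, (hs i).ne'] using h1
    have h1 := hJ.eigenvectorBasis.orthonormal.1 a
    rw [h0, norm_zero] at h1
    exact zero_ne_one h1
  refine ⟨fun a => ⟨hJ.eigenvalues a, abs_le.1 (hbound a)⟩, fun a => v a 0 ^ 2,
    fun a => sq_nonneg _, fun i hi j hj => ?_⟩
  have hij := horth ⟨i, by omega⟩ ⟨j, by omega⟩
  have hveq : ∀ a, ∀ j ≤ N, v a j
      = √(walkWeight p₀ p q j) * (v a 0 * walkPoly r₀ p₀ p q j (hJ.eigenvalues a)) := by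
    intro a j hj
    rw [← hw0, ← hpoly a j hj]
    simp only [w]
    rw [mul_div_cancel₀ _ (hs j).ne']
  have hsum' : ∑ a, v a i * v a j = √(walkWeight p₀ p q i) * √(walkWeight p₀ p q j) *
      ∑ a, v a 0 ^ 2 * (walkPoly r₀ p₀ p q i (hJ.eigenvalues a)
        * walkPoly r₀ p₀ p q j (hJ.eigenvalues a)) := by
    rw [Finset.mul_sum]
    refine Finset.sum_congr rfl fun a _ => ?_
    rw [hveq a i hi, hveq a j hj]
    ring
  simp only [Fin.mk.injEq] at hij
  rw [hsum'] at hij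
  by_cases h : i = j
  · subst h
    simpa [Real.mul_self_sqrt (walkWeight_pos hp₀ hp hq i).le] using hij
  · rw [if_neg h] at hij ⊢
    have := (mul_eq_zero.1 hij).resolve_left (mul_pos (hs i) (hs j)).ne'
    rw [this, mul_zero]

/-- Probability measures on `[-1, 1]` form a compact space, so the quadratures have a limit along an
ultrafilter. Each orthogonality integral is constant once `N ≥ max i j`, so it passes to the limit.
-/
theorem exists_isSpectralMeasure {r₀ p₀ p q : ℝ} (hr₀ : 0 ≤ r₀) (hp₀ : 0 < p₀)
    (hsum : r₀ + p₀ ≤ 1) (hp : 0 < p) (hq : 0 < q) (hpq : p + q = 1) :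
    ∃ ψ : Measure ℝ, IsSpectralMeasure r₀ p₀ p q ψ := by
  choose x c hc horth using exists_quadrature hr₀ hp₀ hsum hp hq hpq
  let ν : ℕ → Measure (Set.Icc (-1 : ℝ) 1) := fun N =>
    ∑ a, ENNReal.ofReal (c N a) • Measure.dirac (x N a)
  have hint : ∀ N (f : Set.Icc (-1 : ℝ) 1 → ℝ), Continuous f →
      ∫ y, f y ∂(ν N) = ∑ a, c N a * f (x N a) := by
    intro N f hf
    have hi : ∀ a ∈ Finset.univ, Integrable f
        (ENNReal.ofReal (c N a) • Measure.dirac (x N a)) := fun a _ =>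
      (integrable_dirac (by simp)).smul_measure ENNReal.ofReal_ne_top
    rw [integral_finsetSum_measure hi]
    refine Finset.sum_congr rfl fun a _ => ?_
    rw [integral_smul_measure, integral_dirac, ENNReal.toReal_ofReal (hc N a), smul_eq_mul]
  have hprob : ∀ N, IsProbabilityMeasure (ν N) := by
    intro N
    constructor
    have h1 : ∑ a, c N a = 1 := by
      simpa [walkWeight, walkPoly] using horth N 0 (Nat.zero_le _) 0 (Nat.zero_le _)
    simp only [ν, Measure.coe_finsetSum, Finset.sum_apply, Measure.smul_apply, measure_univ,
      smul_eq_mul, mul_one]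
    rw [← ENNReal.ofReal_sum_of_nonneg fun a _ => hc N a, h1, ENNReal.ofReal_one]
  let νp : ℕ → ProbabilityMeasure (Set.Icc (-1 : ℝ) 1) := fun N => ⟨ν N, hprob N⟩
  let U : Ultrafilter (ProbabilityMeasure (Set.Icc (-1 : ℝ) 1)) := (hyperfilter ℕ).map νp
  obtain ⟨μ, -, hμ⟩ := isCompact_univ.ultrafilter_le_nhds U (by simp)
  have hlim : Tendsto νp (hyperfilter ℕ) (𝓝 μ) := hμ
  rw [ProbabilityMeasure.tendsto_iff_forall_integral_tendsto] at hlim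
  have hme : MeasurableEmbedding (Subtype.val : Set.Icc (-1 : ℝ) 1 → ℝ) :=
    MeasurableEmbedding.subtype_coe measurableSet_Icc
  refine ⟨(μ : Measure (Set.Icc (-1 : ℝ) 1)).map Subtype.val, ?_, ?_, fun i j => ?_⟩
  · exact Measure.isFiniteMeasure_map _ _
  · rw [hme.map_apply]
    simp
  · rw [hme.integral_map]
    have hcont : Continuous fun y : Set.Icc (-1 : ℝ) 1 =>
        walkPoly r₀ p₀ p q i y * walkPoly r₀ p₀ p q j y := by
      have h1 := continuous_walkPoly r₀ p₀ p q i
      have h2 := continuous_walkPoly r₀ p₀ p q j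
      fun_prop
    have h1 := (hlim (BoundedContinuousFunction.mkOfCompact ⟨_, hcont⟩)).const_mul
      (walkWeight p₀ p q j)
    refine tendsto_nhds_unique_of_eventuallyEq h1 tendsto_const_nhds ?_
    have h2 : ∀ᶠ N in (hyperfilter ℕ : Filter ℕ), max i j ≤ N :=
      (Nat.hyperfilter_le_atTop) (eventually_ge_atTop _)
    filter_upwards [h2] with N hN
    rw [← horth N i ((le_max_left _ _).trans hN) j ((le_max_right _ _).trans hN)]
    congr 1
    exact hint N _ hcont

/-! ### Integral representation and uniqueness. -/

namespace IsSpectralMeasure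

variable {r₀ p₀ p q : ℝ} {ψ : Measure ℝ}

theorem ae_mem_Icc (h : IsSpectralMeasure r₀ p₀ p q ψ) : ∀ᵐ x ∂ψ, x ∈ Set.Icc (-1 : ℝ) 1 :=
  mem_ae_iff.2 h.carried

theorem integrable (h : IsSpectralMeasure r₀ p₀ p q ψ) {f : ℝ → ℝ} (hf : Continuous f) :
    Integrable f ψ := by
  have := h.finite
  obtain ⟨C, hC⟩ := isCompact_Icc.exists_bound_of_continuousOn (hf.continuousOn (s := Set.Icc (-1) 1))
  refine Integrable.of_bound hf.aestronglyMeasurable C ?_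
  filter_upwards [h.ae_mem_Icc] with x hx using hC x hx

/-- The Karlin–McGregor representation of the `n`-step transition probabilities. -/
theorem walkPow_eq (h : IsSpectralMeasure r₀ p₀ p q ψ) (hp₀ : 0 < p₀) (hp : 0 < p) (n i j : ℕ) :
    walkPow r₀ p₀ p q n i j = walkWeight p₀ p q j *
      ∫ x, x ^ n * (walkPoly r₀ p₀ p q i x * walkPoly r₀ p₀ p q j x) ∂ψ := by
  induction n generalizing i with
  | zero =>
    simp only [walkPow, pow_zero, one_mul, h.orthogonal, Matrix.one_apply]
  | succ n ih =>
    have hc := continuous_walkPoly r₀ p₀ p q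
    simp only [walkPow, ih]
    have h1 : ∀ k, walkMatrix r₀ p₀ p q i k * (walkWeight p₀ p q j *
          ∫ x, x ^ n * (walkPoly r₀ p₀ p q k x * walkPoly r₀ p₀ p q j x) ∂ψ)
        = walkWeight p₀ p q j * ∫ x, walkMatrix r₀ p₀ p q i k *
          (x ^ n * (walkPoly r₀ p₀ p q k x * walkPoly r₀ p₀ p q j x)) ∂ψ := by
      intro k
      rw [integral_const_mul]
      ring
    simp only [h1]
    rw [← Finset.mul_sum, ← integral_finsetSum]
    · congr 1
      refine integral_congr_ae (Eventually.of_forall fun x => ?_)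
      have h2 := walkMatrix_sum_walkPoly (r₀ := r₀) (q := q) hp₀.ne' hp.ne' x i
      calc ∑ k ∈ Finset.range (i + 2), walkMatrix r₀ p₀ p q i k *
            (x ^ n * (walkPoly r₀ p₀ p q k x * walkPoly r₀ p₀ p q j x))
          = (∑ k ∈ Finset.range (i + 2), walkMatrix r₀ p₀ p q i k * walkPoly r₀ p₀ p q k x) *
            (x ^ n * walkPoly r₀ p₀ p q j x) := by
            rw [Finset.sum_mul]
            exact Finset.sum_congr rfl fun k _ => by ring
        _ = x ^ (n + 1) * (walkPoly r₀ p₀ p q i x * walkPoly r₀ p₀ p q j x) := by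
            rw [h2]
            ring
    · intro k _
      refine h.integrable ?_
      have := hc k
      have := hc j
      fun_prop

theorem integral_pow (h : IsSpectralMeasure r₀ p₀ p q ψ) (hp₀ : 0 < p₀) (hp : 0 < p) (n : ℕ) :
    ∫ x, x ^ n ∂ψ = walkPow r₀ p₀ p q n 0 0 := by
  rw [h.walkPow_eq hp₀ hp]
  simp [walkWeight, walkPoly]

/-- The moments are the numbers `P^n_{00}`, which do not depend on the measure; polynomials are
uniformly dense on `[-1, 1]`. -/
theorem unique {ψ' : Measure ℝ} (h : IsSpectralMeasure r₀ p₀ p q ψ)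
    (h' : IsSpectralMeasure r₀ p₀ p q ψ') (hp₀ : 0 < p₀) (hp : 0 < p) : ψ = ψ' := by
  have := h.finite
  have := h'.finite
  have hpoly : ∀ P : Polynomial ℝ, ∫ x, P.eval x ∂ψ = ∫ x, P.eval x ∂ψ' := by
    intro P
    simp only [Polynomial.eval_eq_sum_range]
    rw [integral_finsetSum _ fun k _ => h.integrable (by fun_prop),
      integral_finsetSum _ fun k _ => h'.integrable (by fun_prop)]
    refine Finset.sum_congr rfl fun k _ => ?_
    rw [integral_const_mul, integral_const_mul, h.integral_pow hp₀ hp, h'.integral_pow hp₀ hp]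
  refine ext_of_forall_integral_eq_of_IsFiniteMeasure fun f => ?_
  have hbound : ∀ {φ : Measure ℝ}, IsSpectralMeasure r₀ p₀ p q φ → ∀ (P : Polynomial ℝ) (ε : ℝ),
      (∀ x ∈ Set.Icc (-1 : ℝ) 1, |P.eval x - f x| < ε) →
      |∫ x, P.eval x ∂φ - ∫ x, f x ∂φ| ≤ ε * φ.real Set.univ := by
    intro φ hφ P ε hP
    have := hφ.finite
    rw [← integral_sub (hφ.integrable P.continuous) (hφ.integrable f.continuous)]
    rw [← Real.norm_eq_abs]
    refine (norm_integral_le_of_norm_le_const (C := ε) (μ := φ) ?_)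
    filter_upwards [hφ.ae_mem_Icc] with x hx using (hP x hx).le
  by_contra hne
  have hd : 0 < |∫ x, f x ∂ψ - ∫ x, f x ∂ψ'| := abs_pos.2 (sub_ne_zero.2 hne)
  set d := |∫ x, f x ∂ψ - ∫ x, f x ∂ψ'|
  set C := ψ.real Set.univ + ψ'.real Set.univ with hC
  have hC0 : 0 ≤ C := by positivity
  -- This accuracy makes the total error, at most `C` times it, smaller than `d`; `C + 1` avoids
  -- dividing by zero.
  obtain ⟨P, hP⟩ := exists_polynomial_near_of_continuousOn (-1) 1 f f.continuous.continuousOn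
    (d / (2 * (C + 1))) (by positivity)
  have h1 := hbound h P _ hP
  have h2 := hbound h' P _ hP
  rw [hpoly P] at h1
  have h3 : d ≤ d / (2 * (C + 1)) * C := by
    calc d = |(∫ x, P.eval x ∂ψ' - ∫ x, f x ∂ψ') - (∫ x, P.eval x ∂ψ' - ∫ x, f x ∂ψ)| := by
          simp only [d]
          congr 1
          ring
      _ ≤ _ := abs_sub _ _
      _ ≤ _ := add_le_add h2 h1
      _ = _ := by rw [hC]; ring
  have h4 : d / (2 * (C + 1)) * C < d := by
    rw [div_mul_eq_mul_div, div_lt_iff₀ (by positivity)]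
    nlinarith
  exact absurd h3 (not_le.2 h4)

theorem walkWeight_mul_walkPow (h : IsSpectralMeasure r₀ p₀ p q ψ) (hp₀ : 0 < p₀) (hp : 0 < p)
    (n i j : ℕ) : walkWeight p₀ p q i * walkPow r₀ p₀ p q n i j
      = walkWeight p₀ p q j * walkPow r₀ p₀ p q n j i := by
  rw [h.walkPow_eq hp₀ hp, h.walkPow_eq hp₀ hp]
  simp only [mul_comm (walkPoly r₀ p₀ p q j _)]
  ring

theorem neZero (h : IsSpectralMeasure r₀ p₀ p q ψ) : ψ ≠ 0 := by
  rintro rfl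
  simpa using h.orthogonal 0 0

end IsSpectralMeasure

/-! ### Positivity and parity of the transition probabilities. -/

section walkPow

variable {r₀ p₀ p q : ℝ}

theorem walkPow_nonneg (hr₀ : 0 ≤ r₀) (hp₀ : 0 ≤ p₀) (hp : 0 ≤ p) (hq : 0 ≤ q) :
    ∀ n i j : ℕ, 0 ≤ walkPow r₀ p₀ p q n i j
  | 0, i, j => by
    rw [walkPow, Matrix.one_apply]
    split_ifs <;> norm_num
  | n + 1, i, j => Finset.sum_nonneg fun k _ =>
    mul_nonneg (walkMatrix_nonneg hr₀ hp₀ hp hq i k) (walkPow_nonneg hr₀ hp₀ hp hq n k j)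

theorem walkMatrix_mul_walkPow_le (hr₀ : 0 ≤ r₀) (hp₀ : 0 ≤ p₀) (hp : 0 ≤ p) (hq : 0 ≤ q)
    (n i k j : ℕ) (hk : k < i + 2) :
    walkMatrix r₀ p₀ p q i k * walkPow r₀ p₀ p q n k j ≤ walkPow r₀ p₀ p q (n + 1) i j :=
  Finset.single_le_sum (f := fun k => walkMatrix r₀ p₀ p q i k * walkPow r₀ p₀ p q n k j)
    (fun k _ => mul_nonneg (walkMatrix_nonneg hr₀ hp₀ hp hq i k)
      (walkPow_nonneg hr₀ hp₀ hp hq n k j)) (Finset.mem_range.2 hk)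

/-- Keeps only the paths that begin with the direct descent from `k` to `0`. -/
theorem pow_mul_walkPow_zero_le (hr₀ : 0 ≤ r₀) (hp₀ : 0 ≤ p₀) (hp : 0 ≤ p) (hq : 0 ≤ q)
    (n k j : ℕ) : q ^ k * walkPow r₀ p₀ p q n 0 j ≤ walkPow r₀ p₀ p q (n + k) k j := by
  induction k with
  | zero => simp
  | succ k ih =>
    have h1 := walkMatrix_mul_walkPow_le hr₀ hp₀ hp hq (n + k) (k + 1) k j (by omega)
    rw [walkMatrix_succ_self] at h1
    calc q ^ (k + 1) * walkPow r₀ p₀ p q n 0 j = q * (q ^ k * walkPow r₀ p₀ p q n 0 j) := by ring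
      _ ≤ q * walkPow r₀ p₀ p q (n + k) k j := mul_le_mul_of_nonneg_left ih hq
      _ ≤ _ := h1

theorem walkPow_two_mul_pos (hr₀ : 0 ≤ r₀) (hp₀ : 0 < p₀) (hp : 0 < p) (hq : 0 < q) (m : ℕ) :
    0 < walkPow r₀ p₀ p q (2 * m) 0 0 := by
  induction m with
  | zero => simp [walkPow]
  | succ m ih =>
    have h1 := walkMatrix_mul_walkPow_le hr₀ hp₀.le hp.le hq.le (2 * m) 1 0 0 (by omega)
    have h2 := walkMatrix_mul_walkPow_le hr₀ hp₀.le hp.le hq.le (2 * m + 1) 0 1 0 (by omega)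
    rw [walkMatrix_succ_self] at h1
    rw [show walkMatrix r₀ p₀ p q 0 1 = p₀ by simp [walkMatrix]] at h2
    exact (mul_pos hp₀ ((mul_pos hq ih).trans_le h1)).trans_le h2

theorem walkPow_eq_zero_of_odd (n : ℕ) : ∀ i j : ℕ, n % 2 ≠ (i + j) % 2 →
    walkPow 0 p₀ p q n i j = 0 := by
  induction n with
  | zero =>
    intro i j hij
    rw [walkPow, Matrix.one_apply, if_neg]
    omega
  | succ n ih =>
    intro i j hij
    refine Finset.sum_eq_zero fun k _ => ?_
    by_cases hk : n % 2 = (k + j) % 2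
    · have : walkMatrix 0 p₀ p q i k = 0 := by
        rw [walkMatrix, if_neg (by omega), if_neg (by omega), ite_self]
      rw [this, zero_mul]
    · rw [ih k j hk, mul_zero]

end walkPow

/-- Descend from `k` to `0`, spend `n` steps returning to `0`, then climb to `l`. The climb is the
reversal of a descent, hence the factor `π_l q^l`. -/
theorem walkPow_lower_bound {r₀ p₀ p q : ℝ} {ψ : Measure ℝ} (h : IsSpectralMeasure r₀ p₀ p q ψ)
    (hr₀ : 0 ≤ r₀) (hp₀ : 0 < p₀) (hp : 0 < p) (hq : 0 < q) (k l : ℕ) :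
    ∃ c > 0, ∀ n, c * walkPow r₀ p₀ p q n 0 0 ≤ walkPow r₀ p₀ p q (n + (k + l)) k l := by
  have hl := walkWeight_pos hp₀ hp hq l
  refine ⟨walkWeight p₀ p q l * q ^ (k + l), by positivity, fun n => ?_⟩
  have h1 := pow_mul_walkPow_zero_le hr₀ hp₀.le hp.le hq.le n l 0
  have h2 := pow_mul_walkPow_zero_le hr₀ hp₀.le hp.le hq.le (n + l) k l
  have h3 := h.walkWeight_mul_walkPow hp₀ hp (n + l) 0 l
  rw [show walkWeight p₀ p q 0 = 1 from rfl, one_mul] at h3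
  rw [h3] at h2
  rw [add_comm k l, ← add_assoc]
  refine le_trans ?_ h2
  calc walkWeight p₀ p q l * q ^ (l + k) * walkPow r₀ p₀ p q n 0 0
      = q ^ k * (walkWeight p₀ p q l * (q ^ l * walkPow r₀ p₀ p q n 0 0)) := by ring
    _ ≤ _ := by gcongr

/-! ### Concentration of even powers at the end points. -/

section concentration

variable {ψ : Measure ℝ} {η : ℝ}

theorem integrable_of_ae_abs_le [IsFiniteMeasure ψ] (hs : ∀ᵐ x ∂ψ, |x| ≤ η) {f : ℝ → ℝ}
    (hf : Continuous f) : Integrable f ψ := by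
  obtain ⟨C, hC⟩ := isCompact_Icc.exists_bound_of_continuousOn (hf.continuousOn (s := Set.Icc (-η) η))
  refine Integrable.of_bound hf.aestronglyMeasurable C ?_
  filter_upwards [hs] with x hx using hC x (abs_le.1 hx)

theorem pow_mul_measureReal_le_integral_pow [IsFiniteMeasure ψ] (hs : ∀ᵐ x ∂ψ, |x| ≤ η) {a : ℝ}
    (ha : 0 ≤ a) (m : ℕ) : a ^ (2 * m) * ψ.real (Set.Ioi a) ≤ ∫ x, x ^ (2 * m) ∂ψ := by
  have h1 := mul_meas_ge_le_integral_of_nonneg (μ := ψ) (f := fun x : ℝ => x ^ (2 * m))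
    (Eventually.of_forall fun x => (even_two_mul m).pow_nonneg x)
    (integrable_of_ae_abs_le hs (by fun_prop)) (a ^ (2 * m))
  refine le_trans ?_ h1
  refine mul_le_mul_of_nonneg_left (measureReal_mono fun x hx => ?_) (by positivity)
  exact pow_le_pow_left₀ ha (le_of_lt hx) _

/-- The even powers concentrate at the two end points `± η`. -/
theorem tendsto_integral_pow_mul_div [IsFiniteMeasure ψ] (hη : 0 < η) (hs : ∀ᵐ x ∂ψ, |x| ≤ η)
    (hpos : ∀ a < η, ψ (Set.Ioi a) ≠ 0) {h : ℝ → ℝ} (hc : Continuous h) (h1 : h η = 0)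
    (h2 : h (-η) = 0) :
    Tendsto (fun m : ℕ => (∫ x, x ^ (2 * m) * h x ∂ψ) / ∫ x, x ^ (2 * m) ∂ψ) atTop (𝓝 0) := by
  obtain ⟨K, hK⟩ := isCompact_Icc.exists_bound_of_continuousOn (hc.continuousOn (s := Set.Icc (-η) η))
  have hK0 : 0 ≤ K := (norm_nonneg _).trans (hK η ⟨by linarith, le_rfl⟩)
  rw [Metric.tendsto_atTop]
  intro ε hε
  obtain ⟨δ₁, hδ₁, H₁⟩ := Metric.continuousAt_iff.1 (hc.continuousAt (x := η)) (ε / 2) (half_pos hε)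
  obtain ⟨δ₂, hδ₂, H₂⟩ := Metric.continuousAt_iff.1 (hc.continuousAt (x := -η)) (ε / 2) (half_pos hε)
  set δ := min (min δ₁ δ₂) η / 2 with hδ
  have hδ0 : 0 < δ := by positivity
  have hδη : δ < η := by
    have := min_le_right (min δ₁ δ₂) η
    linarith
  have hδa : δ < δ₁ := by
    have := (min_le_left (min δ₁ δ₂) η).trans (min_le_left _ _)
    linarith
  have hδb : δ < δ₂ := by
    have := (min_le_left (min δ₁ δ₂) η).trans (min_le_right _ _)
    linarith
  -- Here `0 < b < a < η`. For `|x| ≤ b` the numerator contributes at most `K b^(2m) ψ(ℝ)`, against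
  -- a denominator of at least `a^(2m) ψ(a, ∞)`; for `b < |x| ≤ η` the function `h` is below `ε /
  -- 2`.
  set b := η - δ with hb
  set a := η - δ / 2 with ha
  have hb0 : 0 < b := by linarith
  have ha0 : 0 < a := by linarith
  have hc0 : 0 < ψ.real (Set.Ioi a) :=
    (ENNReal.toReal_pos (hpos a (by linarith)) (measure_ne_top _ _))
  have hlow := fun m => pow_mul_measureReal_le_integral_pow hs ha0.le m
  have hlim : Tendsto (fun m : ℕ => K * ψ.real Set.univ / ψ.real (Set.Ioi a) * ((b / a) ^ 2) ^ m)
      atTop (𝓝 (K * ψ.real Set.univ / ψ.real (Set.Ioi a) * 0)) := by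
    refine (tendsto_pow_atTop_nhds_zero_of_lt_one (by positivity) ?_).const_mul _
    have : b / a < 1 := (div_lt_one ha0).2 (by linarith)
    exact pow_lt_one₀ (by positivity) this two_ne_zero
  rw [mul_zero] at hlim
  obtain ⟨N, hN⟩ := eventually_atTop.1 (hlim.eventually_lt_const (half_pos hε))
  refine ⟨N, fun m hm => ?_⟩
  have hμ : 0 < ∫ x, x ^ (2 * m) ∂ψ := (mul_pos (pow_pos ha0 _) hc0).trans_le (hlow m)
  rw [Real.dist_eq, sub_zero, abs_div, abs_of_pos hμ, div_lt_iff₀ hμ]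
  have hptw : ∀ᵐ x ∂ψ, ‖x ^ (2 * m) * h x‖ ≤ ε / 2 * x ^ (2 * m) + K * b ^ (2 * m) := by
    filter_upwards [hs] with x hx
    have hxp : 0 ≤ x ^ (2 * m) := (even_two_mul m).pow_nonneg x
    rw [norm_mul, Real.norm_eq_abs, abs_of_nonneg hxp]
    by_cases hxb : |x| ≤ b
    · have h3 : x ^ (2 * m) ≤ b ^ (2 * m) := by
        rw [← (even_two_mul m).pow_abs]
        exact pow_le_pow_left₀ (abs_nonneg x) hxb _
      have h4 := mul_le_mul h3 (hK x (abs_le.1 hx)) (norm_nonneg _) (by positivity)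
      have : 0 ≤ ε / 2 * x ^ (2 * m) := by positivity
      linarith
    · have hh : ‖h x‖ ≤ ε / 2 := by
        push Not at hxb
        rcases abs_cases x with ⟨h5, _⟩ | ⟨h5, _⟩ <;> rw [h5] at hx hxb
        · have := H₁ (x := x) (by rw [Real.dist_eq, abs_lt]; constructor <;> linarith)
          rw [h1, dist_zero_right] at this
          exact this.le
        · have := H₂ (x := x) (by rw [Real.dist_eq, abs_lt]; constructor <;> linarith)
          rw [h2, dist_zero_right] at this
          exact this.le
      have h4 := mul_le_mul_of_nonneg_left hh hxp
      have : 0 ≤ K * b ^ (2 * m) := by positivity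
      linarith
  have hint1 : Integrable (fun x : ℝ => ε / 2 * x ^ (2 * m)) ψ :=
    integrable_of_ae_abs_le hs (by fun_prop)
  have h5 := norm_integral_le_of_norm_le (hint1.add (integrable_const (K * b ^ (2 * m)))) hptw
  rw [Real.norm_eq_abs] at h5
  simp only [Pi.add_apply] at h5
  rw [integral_add hint1 (integrable_const _), integral_const_mul, integral_const,
    smul_eq_mul] at h5
  have h6 := hN m hm
  have h7 : ψ.real Set.univ * (K * b ^ (2 * m)) < ε / 2 * ∫ x, x ^ (2 * m) ∂ψ := by
    calc ψ.real Set.univ * (K * b ^ (2 * m))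
        = K * ψ.real Set.univ / ψ.real (Set.Ioi a) * ((b / a) ^ 2) ^ m *
            (a ^ (2 * m) * ψ.real (Set.Ioi a)) := by
          rw [← pow_mul, div_pow]
          field_simp
      _ ≤ K * ψ.real Set.univ / ψ.real (Set.Ioi a) * ((b / a) ^ 2) ^ m *
            ∫ x, x ^ (2 * m) ∂ψ := mul_le_mul_of_nonneg_left (hlow m) (by positivity)
      _ < _ := mul_lt_mul_of_pos_right h6 hμ
  linarith

theorem integral_pow_two_mul_pos [IsFiniteMeasure ψ] (hη : 0 < η) (hs : ∀ᵐ x ∂ψ, |x| ≤ η)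
    (hpos : ∀ a < η, ψ (Set.Ioi a) ≠ 0) (m : ℕ) : 0 < ∫ x, x ^ (2 * m) ∂ψ := by
  have h1 := pow_mul_measureReal_le_integral_pow hs (half_pos hη).le m
  refine lt_of_lt_of_le (mul_pos (by positivity) ?_) h1
  exact ENNReal.toReal_pos (hpos _ (half_lt_self hη)) (measure_ne_top _ _)

/-- Subtract from `h` its linear interpolant `a + b x` at `±η`: the remainder is negligible by
concentration, and the interpolant only involves `L`. -/
theorem tendsto_integral_pow_mul_div_of_tendsto [IsFiniteMeasure ψ] (hη : 0 < η)
    (hs : ∀ᵐ x ∂ψ, |x| ≤ η) (hpos : ∀ a < η, ψ (Set.Ioi a) ≠ 0) {L : ℝ}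
    (hL : Tendsto (fun m : ℕ => (∫ x, x ^ (2 * m + 1) ∂ψ) / ∫ x, x ^ (2 * m) ∂ψ) atTop (𝓝 L))
    {h : ℝ → ℝ} (hc : Continuous h) :
    Tendsto (fun m : ℕ => (∫ x, x ^ (2 * m) * h x ∂ψ) / ∫ x, x ^ (2 * m) ∂ψ) atTop
      (𝓝 ((h η + h (-η)) / 2 + (h η - h (-η)) / (2 * η) * L)) := by
  set a := (h η + h (-η)) / 2 with ha
  set b := (h η - h (-η)) / (2 * η) with hb
  have hbη : b * η = (h η - h (-η)) / 2 := by
    rw [hb]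
    field_simp
  have h1 := tendsto_integral_pow_mul_div hη hs hpos (h := fun x => h x - a - b * x)
    (by fun_prop) (by rw [hbη, ha]; ring) (by rw [mul_neg, hbη, ha]; ring)
  have h2 := (h1.add_const a).add (hL.const_mul b)
  rw [zero_add] at h2
  refine h2.congr fun m => ?_
  have hμ := integral_pow_two_mul_pos hη hs hpos m
  have h3 : ∫ x, x ^ (2 * m) * (h x - a - b * x) ∂ψ
      = ∫ x, x ^ (2 * m) * h x ∂ψ - a * ∫ x, x ^ (2 * m) ∂ψ - b * ∫ x, x ^ (2 * m + 1) ∂ψ := by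
    rw [← integral_const_mul, ← integral_const_mul, ← integral_sub, ← integral_sub]
    · exact integral_congr_ae (Eventually.of_forall fun x => by simp only; ring)
    all_goals exact integrable_of_ae_abs_le hs (by fun_prop)
  rw [h3]
  field_simp
  ring

/-- Mass below `-a` would contribute at most `-a^(2m+1)` times itself to an odd moment, and the
positive part, of order `max η 0 ^ (2m+1)`, could not compensate. The maximum with `0` is there
because the sign of `η` is not yet known. -/
theorem ae_neg_max_le_of_odd_moments_nonneg [IsFiniteMeasure ψ] (hodd : ∀ m : ℕ, 0 ≤ ∫ x, x ^ (2 * m + 1) ∂ψ)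
    (hs : ∀ᵐ x ∂ψ, x ≤ η) (hint : ∀ m : ℕ, Integrable (fun x : ℝ => x ^ (2 * m + 1)) ψ) :
    ∀ a, max η 0 < a → ψ (Set.Iio (-a)) = 0 := by
  intro a ha
  by_contra hne
  set M := max η 0 with hM
  have hM0 : 0 ≤ M := le_max_right _ _
  have ha0 : 0 < a := hM0.trans_lt ha
  have hc0 : 0 < ψ.real (Set.Iio (-a)) := ENNReal.toReal_pos hne (measure_ne_top _ _)
  have hle : ∀ m : ℕ, a ^ (2 * m + 1) * ψ.real (Set.Iio (-a)) ≤ M ^ (2 * m + 1) * ψ.real Set.univ := by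
    intro m
    have hi : Integrable ((Set.Iio (-a)).indicator fun _ : ℝ => a ^ (2 * m + 1)) ψ :=
      (integrable_const _).indicator measurableSet_Iio
    have hm : ∫ x, x ^ (2 * m + 1) ∂ψ ≤ ∫ x, (M ^ (2 * m + 1) -
        (Set.Iio (-a)).indicator (fun _ : ℝ => a ^ (2 * m + 1)) x) ∂ψ := by
      refine integral_mono_ae (hint m) ((integrable_const _).sub hi) ?_
      filter_upwards [hs] with x hx
      have hmono : StrictMono fun x : ℝ => x ^ (2 * m + 1) :=
        Odd.strictMono_pow (odd_two_mul_add_one m)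
      by_cases hxa : x ∈ Set.Iio (-a)
      · rw [Set.indicator_of_mem hxa]
        have h1 : x ^ (2 * m + 1) ≤ (-a) ^ (2 * m + 1) := hmono.monotone (le_of_lt hxa)
        rw [(odd_two_mul_add_one m).neg_pow] at h1
        have : 0 ≤ M ^ (2 * m + 1) := by positivity
        linarith
      · rw [Set.indicator_of_notMem hxa, sub_zero]
        exact hmono.monotone (hx.trans (le_max_left _ _))
    rw [integral_sub (integrable_const _) hi, integral_const, integral_indicator_const _ measurableSet_Iio,
      smul_eq_mul, smul_eq_mul] at hm
    have := hodd m
    linarith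
  have hlim : Tendsto (fun m : ℕ => M / a * ((M / a) ^ 2) ^ m * ψ.real Set.univ) atTop
      (𝓝 (M / a * 0 * ψ.real Set.univ)) := by
    refine ((tendsto_pow_atTop_nhds_zero_of_lt_one (by positivity) ?_).const_mul _).mul_const _
    exact pow_lt_one₀ (by positivity) ((div_lt_one ha0).2 ha) two_ne_zero
  rw [mul_zero, zero_mul] at hlim
  refine absurd (ge_of_tendsto' hlim fun m => ?_) (not_le.2 hc0)
  have h1 := hle m
  have h2 : M / a * ((M / a) ^ 2) ^ m * ψ.real Set.univ
      = M ^ (2 * m + 1) * ψ.real Set.univ / a ^ (2 * m + 1) := by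
    rw [← pow_mul, ← pow_succ', div_pow]
    ring
  rw [h2, le_div_iff₀ (by positivity)]
  linarith

end concentration

/-! ### The top of the support. -/

namespace IsSpectralMeasure

variable {r₀ p₀ p q : ℝ} {ψ : Measure ℝ}

theorem support_subset (h : IsSpectralMeasure r₀ p₀ p q ψ) : ψ.support ⊆ Set.Icc (-1) 1 :=
  Measure.support_subset_of_isClosed isClosed_Icc h.ae_mem_Icc

theorem supportTop_mem (h : IsSpectralMeasure r₀ p₀ p q ψ) : supportTop ψ ∈ ψ.support :=
  Measure.isClosed_support.csSup_mem (Measure.nonempty_support h.neZero)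
    (bddAbove_Icc.mono h.support_subset)

theorem measure_Ioi_ne_zero (h : IsSpectralMeasure r₀ p₀ p q ψ) (a : ℝ) (ha : a < supportTop ψ) :
    ψ (Set.Ioi a) ≠ 0 :=
  ((Measure.mem_support_iff_forall _).1 h.supportTop_mem _ (Ioi_mem_nhds ha)).ne'

theorem ae_le_supportTop (h : IsSpectralMeasure r₀ p₀ p q ψ) : ∀ᵐ x ∂ψ, x ≤ supportTop ψ := by
  filter_upwards [Measure.support_mem_ae (μ := ψ)] with x hx
  exact le_csSup (bddAbove_Icc.mono h.support_subset) hx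

theorem supportTop_pos_and_ae_abs_le (h : IsSpectralMeasure r₀ p₀ p q ψ) (hr₀ : 0 ≤ r₀) (hp₀ : 0 < p₀)
    (hp : 0 < p) (hq : 0 < q) : 0 < supportTop ψ ∧ ∀ᵐ x ∂ψ, |x| ≤ supportTop ψ := by
  have := h.finite
  have h1 := ae_neg_max_le_of_odd_moments_nonneg (ψ := ψ) (η := supportTop ψ) (fun m => by
    rw [h.integral_pow hp₀ hp]
    exact walkPow_nonneg hr₀ hp₀.le hp.le hq.le _ _ _) h.ae_le_supportTop
    (fun m => h.integrable (by fun_prop))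
  have h2 : ∀ᵐ x ∂ψ, -(max (supportTop ψ) 0) ≤ x := by
    filter_upwards [Measure.support_mem_ae (μ := ψ)] with x hx
    by_contra! hlt
    obtain ⟨a, ha1, ha2⟩ := exists_between (lt_neg_of_lt_neg hlt)
    exact ((Measure.mem_support_iff_forall _).1 hx _ (Iio_mem_nhds (lt_neg_of_lt_neg ha2))).ne'
      (h1 a ha1)
  -- Otherwise `ψ` would sit at `0`, against `P²_{00} > 0`.
  have hpos : 0 < supportTop ψ := by
    by_contra! hle
    rw [max_eq_right hle, neg_zero] at h2
    have h3 : ∫ x, x ^ (2 * 1) ∂ψ = 0 := by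
      refine integral_eq_zero_of_ae ?_
      filter_upwards [h2, h.ae_le_supportTop] with x hx1 hx2
      have : x = 0 := le_antisymm (hx2.trans hle) hx1
      simp [this]
    rw [h.integral_pow hp₀ hp] at h3
    exact (walkPow_two_mul_pos hr₀ hp₀ hp hq 1).ne' h3
  refine ⟨hpos, ?_⟩
  rw [max_eq_left hpos.le] at h2
  filter_upwards [h2, h.ae_le_supportTop] with x hx1 hx2 using abs_le.2 ⟨hx1, hx2⟩

end IsSpectralMeasure

/-! ### Point masses and roots of the characteristic equation. -/

theorem walkPoly_eq_pow {r₀ p₀ p q x : ℝ} (hp : p ≠ 0)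
    (h : p * walkPoly r₀ p₀ p q 1 x ^ 2 - x * walkPoly r₀ p₀ p q 1 x + q = 0) :
    ∀ j, walkPoly r₀ p₀ p q j x = walkPoly r₀ p₀ p q 1 x ^ j
  | 0 => by simp [walkPoly]
  | 1 => by simp
  | j + 2 => by
    rw [walkPoly.eq_3, walkPoly_eq_pow hp h (j + 1), walkPoly_eq_pow hp h j, div_eq_iff hp]
    linear_combination walkPoly r₀ p₀ p q 1 x ^ j * -h

/-- Iterated eigenvalue equation; the sum is finite because `n` steps from `i` reach at most `i +
n`. -/
theorem pow_mul_walkPoly_eq_sum {r₀ p₀ p q : ℝ} (hp₀ : p₀ ≠ 0) (hp : p ≠ 0) (x : ℝ) (n : ℕ) :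
    ∀ i M, i + n + 1 ≤ M → x ^ n * walkPoly r₀ p₀ p q i x
      = ∑ j ∈ Finset.range M, walkPow r₀ p₀ p q n i j * walkPoly r₀ p₀ p q j x := by
  induction n with
  | zero =>
    intro i M hM
    simp only [walkPow, Matrix.one_apply, ite_mul, one_mul, zero_mul, pow_zero]
    rw [Finset.sum_ite_eq, if_pos (Finset.mem_range.2 (by omega))]
  | succ n ih =>
    intro i M hM
    simp only [walkPow, Finset.sum_mul]
    rw [Finset.sum_comm]
    calc x ^ (n + 1) * walkPoly r₀ p₀ p q i x
        = x ^ n * (x * walkPoly r₀ p₀ p q i x) := by ring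
      _ = ∑ k ∈ Finset.range (i + 2),
            walkMatrix r₀ p₀ p q i k * (x ^ n * walkPoly r₀ p₀ p q k x) := by
          rw [← walkMatrix_sum_walkPoly hp₀ hp, Finset.mul_sum]
          exact Finset.sum_congr rfl fun k _ => by ring
      _ = _ := by
          refine Finset.sum_congr rfl fun k hk => ?_
          have := Finset.mem_range.1 hk
          rw [ih k M (by omega), Finset.mul_sum]
          exact Finset.sum_congr rfl fun j _ => by ring

/-- If the terms `π_j Q_j(x)²` tend to zero, then `Q_j(x) = w ^ j` for a root `w` of the
characteristic equation, inside the disc of square summability. -/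
theorem char_eq_of_tendsto_zero {r₀ p₀ p q x : ℝ} (hp₀ : 0 < p₀) (hp : 0 < p) (hq : 0 < q)
    (h : Tendsto (fun j => walkWeight p₀ p q j * walkPoly r₀ p₀ p q j x ^ 2) atTop (𝓝 0)) :
    p * walkPoly r₀ p₀ p q 1 x ^ 2 - x * walkPoly r₀ p₀ p q 1 x + q = 0 ∧
      p * walkPoly r₀ p₀ p q 1 x ^ 2 < q := by
  -- A quadratic invariant of the three-term recurrence. It is bounded by multiples of `π_j Q_j²`
  -- and `π_{j+1} Q_{j+1}²`, so it must vanish.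
  have hinv : ∀ j, (p / q) ^ j * (p * walkPoly r₀ p₀ p q (j + 1) x ^ 2
      - x * (walkPoly r₀ p₀ p q j x * walkPoly r₀ p₀ p q (j + 1) x)
      + q * walkPoly r₀ p₀ p q j x ^ 2)
      = p * walkPoly r₀ p₀ p q 1 x ^ 2 - x * walkPoly r₀ p₀ p q 1 x + q := by
    intro j
    induction j with
    | zero => simp [walkPoly]
    | succ j ih =>
      rw [← ih, pow_succ, mul_assoc]
      congr 1
      rw [walkPoly]
      field_simp
      ring
  have h1 := (tendsto_add_atTop_iff_nat 1).2 h
  have h2 := (tendsto_add_atTop_iff_nat 2).2 h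
  have hlim : Tendsto (fun j => (p + |x|) * (q / p₀) *
        (walkWeight p₀ p q (j + 2) * walkPoly r₀ p₀ p q (j + 2) x ^ 2)
      + (q + |x|) * (p / p₀) *
        (walkWeight p₀ p q (j + 1) * walkPoly r₀ p₀ p q (j + 1) x ^ 2)) atTop (𝓝 0) := by
    simpa using (h2.const_mul ((p + |x|) * (q / p₀))).add (h1.const_mul ((q + |x|) * (p / p₀)))
  have hzero : p * walkPoly r₀ p₀ p q 1 x ^ 2 - x * walkPoly r₀ p₀ p q 1 x + q = 0 := by
    refine abs_eq_zero.1 (le_antisymm (ge_of_tendsto' hlim fun j => ?_) (abs_nonneg _))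
    rw [← hinv (j + 1)]
    set a := walkPoly r₀ p₀ p q (j + 2) x
    set b := walkPoly r₀ p₀ p q (j + 1) x
    have e1 : (p + |x|) * (q / p₀) * (walkWeight p₀ p q (j + 2) * a ^ 2)
        + (q + |x|) * (p / p₀) * (walkWeight p₀ p q (j + 1) * b ^ 2)
        = (p / q) ^ (j + 1) * ((p + |x|) * a ^ 2 + (q + |x|) * b ^ 2) := by
      simp only [walkWeight, div_pow]
      field_simp
      ring
    rw [e1, abs_mul, abs_of_pos (show 0 < (p / q) ^ (j + 1) by positivity)]
    refine mul_le_mul_of_nonneg_left ?_ (by positivity)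
    have e2 : |x * (b * a)| ≤ |x| * (a ^ 2 + b ^ 2) := by
      rw [abs_mul]
      refine mul_le_mul_of_nonneg_left ?_ (abs_nonneg x)
      rw [abs_le]
      constructor <;> nlinarith [sq_nonneg (a + b), sq_nonneg (a - b), sq_nonneg a, sq_nonneg b]
    have e3 : 0 ≤ p * a ^ 2 := by positivity
    have e4 : 0 ≤ q * b ^ 2 := by positivity
    rw [abs_le] at e2 ⊢
    constructor <;> linarith [e2.1, e2.2]
  refine ⟨hzero, ?_⟩
  -- If `p w² ≥ q`, the terms `π_j w^(2j)` with `j ≥ 1` do not decrease and cannot tend to zero.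
  by_contra! hge
  set w := walkPoly r₀ p₀ p q 1 x with hw
  have hw0 : w ≠ 0 := by
    intro hw0
    rw [hw0] at hzero
    simp [hq.ne'] at hzero
  have h3 : p₀ * w ^ 2 / q ≤ 0 := by
    refine ge_of_tendsto' h1 fun j => ?_
    rw [walkPoly_eq_pow hp.ne' hzero (j + 1), ← hw]
    have e : walkWeight p₀ p q (j + 1) * (w ^ (j + 1)) ^ 2
        = p₀ * w ^ 2 / q * (p * w ^ 2 / q) ^ j := by
      simp only [walkWeight, div_pow, mul_pow]
      field_simp
      ring
    rw [e]
    exact le_mul_of_one_le_right (by positivity) (one_le_pow₀ ((one_le_div hq).2 hge))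
  have h4 : 0 < p₀ * w ^ 2 / q := by positivity
  exact absurd h3 (not_le.2 h4)

/-- For a root `w < 0`, the quadratic equals `2 r₀ w ≤ 0` at `-w` and `q > 0` at `0`, so it has a
root in `(0, -w]`. -/
theorem exists_pos_root {r₀ p₀ p q w : ℝ} (hr₀ : 0 ≤ r₀) (hp : 0 < p) (hq : 0 < q)
    (h : (p - p₀) * w ^ 2 - r₀ * w + q = 0) (hw : p * w ^ 2 < q) :
    ∃ w' > 0, (p - p₀) * w' ^ 2 - r₀ * w' + q = 0 ∧ p * w' ^ 2 < q := by
  rcases lt_trichotomy w 0 with hw0 | hw0 | hw0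
  · have hcont : ContinuousOn (fun t => (p - p₀) * t ^ 2 - r₀ * t + q) (Set.Icc 0 (-w)) := by
      fun_prop
    obtain ⟨t, ⟨ht0, ht1⟩, ht⟩ := intermediate_value_Icc' (by linarith : (0 : ℝ) ≤ -w) hcont
      (show (0 : ℝ) ∈ Set.Icc _ _ from ⟨by nlinarith, by simp [hq.le]⟩)
    simp only at ht
    have ht0' : t ≠ 0 := by
      rintro rfl
      simp [hq.ne'] at ht
    refine ⟨t, lt_of_le_of_ne ht0 ht0'.symm, ht, lt_of_le_of_lt ?_ hw⟩
    have : t ^ 2 ≤ w ^ 2 := by nlinarith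
    exact mul_le_mul_of_nonneg_left this hp.le
  · rw [hw0] at h
    simp [hq.ne'] at h
  · exact ⟨w, hw0, h, hw⟩

/-- At `s = √(q/p)` the quadratic equals `-r₀ s < 0`, at `0` it is `q > 0`. -/
theorem exists_pos_root_of_eq_two_mul {r₀ p₀ p q : ℝ} (hr₀ : 0 < r₀) (hp : 0 < p) (hq : 0 < q)
    (h : p₀ = 2 * p) :
    ∃ w > 0, (p - p₀) * w ^ 2 - r₀ * w + q = 0 ∧ p * w ^ 2 < q := by
  set s := √(q / p) with hs
  have hs0 : 0 < s := Real.sqrt_pos.2 (by positivity)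
  have hs2 : p * s ^ 2 = q := by
    rw [hs, Real.sq_sqrt (by positivity)]
    field_simp
  have hcont : ContinuousOn (fun t => (p - p₀) * t ^ 2 - r₀ * t + q) (Set.Icc 0 s) := by fun_prop
  obtain ⟨t, ⟨ht0, ht1⟩, ht⟩ := intermediate_value_Ioo' hs0.le hcont
    (show (0 : ℝ) ∈ Set.Ioo _ _ from ⟨by nlinarith [mul_pos hr₀ hs0], by simp [hq]⟩)
  refine ⟨t, ht0, ht, ?_⟩
  nlinarith

theorem tendsto_integral_div_pow {ψ : Measure ℝ} [IsFiniteMeasure ψ] {η : ℝ} (hη : 0 < η)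
    (hs : ∀ᵐ x ∂ψ, |x| ≤ η) (h0 : ψ {-η} = 0) :
    Tendsto (fun n : ℕ => ∫ x, (x / η) ^ n ∂ψ) atTop (𝓝 (ψ.real {η})) := by
  have h1 : ∫ x, ({η} : Set ℝ).indicator (fun _ => (1 : ℝ)) x ∂ψ = ψ.real {η} := by
    rw [integral_indicator_const _ (measurableSet_singleton _), smul_eq_mul, mul_one]
  rw [← h1]
  refine tendsto_integral_of_dominated_convergence (fun _ => 1)
    (fun n => (by fun_prop : Continuous fun x : ℝ => (x / η) ^ n).aestronglyMeasurable)
    (integrable_const _) (fun n => ?_) ?_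
  · filter_upwards [hs] with x hx
    rw [norm_pow, Real.norm_eq_abs, abs_div, abs_of_pos hη]
    exact pow_le_one₀ (by positivity) ((div_le_one hη).2 hx)
  · have h2 : ∀ᵐ x ∂ψ, x ≠ -η := by
      rw [ae_iff]
      simpa using h0
    filter_upwards [hs, h2] with x hx hx'
    by_cases hxη : x = η
    · subst hxη
      simp [hη.ne']
    · rw [Set.indicator_of_notMem (by simpa using hxη)]
      refine tendsto_pow_atTop_nhds_zero_of_abs_lt_one ?_
      rw [abs_div, abs_of_pos hη, div_lt_one hη]
      refine lt_of_le_of_ne hx fun he => ?_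
      rcases eq_or_eq_neg_of_abs_eq he with h3 | h3
      · exact hxη h3
      · exact hx' h3

namespace IsSpectralMeasure

variable {r₀ p₀ p q : ℝ} {ψ : Measure ℝ}

theorem integral_sum_sq (h : IsSpectralMeasure r₀ p₀ p q ψ) (a : ℕ → ℝ) (N : ℕ) :
    ∫ x, (∑ j ∈ Finset.range N, walkWeight p₀ p q j * a j * walkPoly r₀ p₀ p q j x) ^ 2 ∂ψ
      = ∑ j ∈ Finset.range N, walkWeight p₀ p q j * a j ^ 2 := by
  have hc := continuous_walkPoly r₀ p₀ p q
  have hint : ∀ i j, Integrable (fun x => walkWeight p₀ p q i * a i * a j *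
      (walkWeight p₀ p q j * (walkPoly r₀ p₀ p q i x * walkPoly r₀ p₀ p q j x))) ψ := by
    intro i j
    refine h.integrable ?_
    have := hc i
    have := hc j
    fun_prop
  have h1 : ∀ x, (∑ j ∈ Finset.range N, walkWeight p₀ p q j * a j * walkPoly r₀ p₀ p q j x) ^ 2
      = ∑ i ∈ Finset.range N, ∑ j ∈ Finset.range N, walkWeight p₀ p q i * a i * a j *
        (walkWeight p₀ p q j * (walkPoly r₀ p₀ p q i x * walkPoly r₀ p₀ p q j x)) := by
    intro x
    rw [sq, Finset.sum_mul_sum]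
    exact Finset.sum_congr rfl fun i _ => Finset.sum_congr rfl fun j _ => by ring
  simp only [h1]
  rw [integral_finsetSum _ fun i _ => integrable_finsetSum _ fun j _ => hint i j]
  refine Finset.sum_congr rfl fun i hi => ?_
  rw [integral_finsetSum _ fun j _ => hint i j]
  simp only [integral_const_mul, h.orthogonal]
  simp only [mul_ite, mul_one, mul_zero]
  rw [Finset.sum_ite_eq, if_pos hi]
  ring

/-- Bessel's inequality for the indicator function of a point. -/
theorem sum_mul_measureReal_singleton_le (h : IsSpectralMeasure r₀ p₀ p q ψ) (hp₀ : 0 < p₀)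
    (hp : 0 < p) (hq : 0 < q) (x : ℝ) (N : ℕ) :
    (∑ j ∈ Finset.range N, walkWeight p₀ p q j * walkPoly r₀ p₀ p q j x ^ 2) * ψ.real {x} ≤ 1 := by
  have := h.finite
  have hc := continuous_walkPoly r₀ p₀ p q
  set S := ∑ j ∈ Finset.range N, walkWeight p₀ p q j * walkPoly r₀ p₀ p q j x ^ 2 with hS
  have hS0 : 0 ≤ S := Finset.sum_nonneg fun j _ =>
    mul_nonneg (walkWeight_pos hp₀ hp hq j).le (sq_nonneg _)
  have h1 := h.integral_sum_sq (fun j => walkPoly r₀ p₀ p q j x) N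
  -- Restricting the integral to `{x}` gives `S² ψ{x} ≤ S`.
  have h2 : ∫ y in {x}, (∑ j ∈ Finset.range N, walkWeight p₀ p q j * walkPoly r₀ p₀ p q j x *
      walkPoly r₀ p₀ p q j y) ^ 2 ∂ψ ≤ S := by
    rw [hS, ← h1]
    refine setIntegral_le_integral (h.integrable ?_) (Eventually.of_forall fun y => sq_nonneg _)
    fun_prop
  rw [integral_singleton, smul_eq_mul] at h2
  have h3 : ∑ j ∈ Finset.range N, walkWeight p₀ p q j * walkPoly r₀ p₀ p q j x *
      walkPoly r₀ p₀ p q j x = S := Finset.sum_congr rfl fun j _ => by ring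
  rw [h3] at h2
  rcases hS0.eq_or_lt with h4 | h4
  · rw [← h4, zero_mul]
    exact zero_le_one
  · refine le_of_mul_le_mul_left ?_ h4
    linarith

theorem char_eq_of_measure_singleton_ne_zero (h : IsSpectralMeasure r₀ p₀ p q ψ) (hp₀ : 0 < p₀)
    (hp : 0 < p) (hq : 0 < q) {x : ℝ} (hx : ψ {x} ≠ 0) :
    p * walkPoly r₀ p₀ p q 1 x ^ 2 - x * walkPoly r₀ p₀ p q 1 x + q = 0 ∧
      p * walkPoly r₀ p₀ p q 1 x ^ 2 < q := by
  have := h.finite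
  have hx0 : 0 < ψ.real {x} := ENNReal.toReal_pos hx (measure_ne_top _ _)
  refine char_eq_of_tendsto_zero hp₀ hp hq (Summable.tendsto_atTop_zero ?_)
  refine summable_of_sum_range_le (c := 1 / ψ.real {x})
    (fun j => mul_nonneg (walkWeight_pos hp₀ hp hq j).le (sq_nonneg _)) fun N => ?_
  rw [le_div_iff₀ hx0]
  exact h.sum_mul_measureReal_singleton_le hp₀ hp hq x N

/-- A square summable positive eigenvector carries a point mass at the top of the support. -/
theorem point_mass_of_root (h : IsSpectralMeasure r₀ p₀ p q ψ) (hr₀ : 0 < r₀) (hp₀ : 0 < p₀)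
    (hp : 0 < p) (hq : 0 < q) {w : ℝ} (hw : 0 < w) (hG : (p - p₀) * w ^ 2 - r₀ * w + q = 0)
    (hwq : p * w ^ 2 < q) :
    ψ {supportTop ψ} ≠ 0 ∧ ψ {-supportTop ψ} = 0 := by
  have := h.finite
  -- The point at which `Q_1` takes the value `w`; the equation for `w` then gives `Q_j(t) = w^j`
  -- for all `j`.
  set t := r₀ + p₀ * w with ht
  have ht0 : 0 < t := by positivity
  have hQ1 : walkPoly r₀ p₀ p q 1 t = w := by
    simp only [walkPoly, ht]
    field_simp
    ring
  have hchar : p * w ^ 2 - t * w + q = 0 := by rw [ht]; linear_combination hG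
  have hQ : ∀ j, walkPoly r₀ p₀ p q j t = w ^ j := by
    intro j
    rw [walkPoly_eq_pow hp.ne' (by rw [hQ1]; exact hchar) j, hQ1]
  have hexp : ∀ n, t ^ n = ∑ j ∈ Finset.range (n + 1), walkPow r₀ p₀ p q n 0 j * w ^ j := by
    intro n
    have := pow_mul_walkPoly_eq_sum (r₀ := r₀) (q := q) hp₀.ne' hp.ne' t n 0 (n + 1) (by omega)
    simpa [hQ] using this
  have hmom : ∀ n, ∫ x, x ^ n ∂ψ ≤ t ^ n := by
    intro n
    rw [h.integral_pow hp₀ hp, hexp]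
    have := Finset.single_le_sum (f := fun j => walkPow r₀ p₀ p q n 0 j * w ^ j)
      (fun j _ => mul_nonneg (walkPow_nonneg hr₀.le hp₀.le hp.le hq.le n 0 j) (by positivity))
      (Finset.mem_range.2 (Nat.succ_pos n))
    simpa using this
  obtain ⟨hη, hs⟩ := h.supportTop_pos_and_ae_abs_le hr₀.le hp₀ hp hq
  have hηt : supportTop ψ ≤ t := by
    by_contra! hlt
    obtain ⟨a, ha1, ha2⟩ := exists_between hlt
    have ha0 : 0 < a := ht0.trans ha1
    have hc0 : 0 < ψ.real (Set.Ioi a) :=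
      ENNReal.toReal_pos (h.measure_Ioi_ne_zero a ha2) (measure_ne_top _ _)
    have hlim : Tendsto (fun m : ℕ => ((t / a) ^ 2) ^ m) atTop (𝓝 0) :=
      tendsto_pow_atTop_nhds_zero_of_lt_one (by positivity)
        (pow_lt_one₀ (by positivity) ((div_lt_one ha0).2 ha1) two_ne_zero)
    refine absurd (ge_of_tendsto' hlim fun m => ?_) (not_le.2 hc0)
    rw [← pow_mul, div_pow, le_div_iff₀ (by positivity), mul_comm]
    exact (pow_mul_measureReal_le_integral_pow hs ha0.le m).trans (hmom _)
  have hst : ∀ᵐ x ∂ψ, |x| ≤ t := hs.mono fun x hx => hx.trans hηt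
  -- An atom at `-t` would make `w` and `w + d` two distinct roots of `p z² - t z + q`, with product
  -- `q / p`, although both satisfy `p z² < q`.
  have hneg : ψ {-t} = 0 := by
    by_contra hne
    obtain ⟨h1, h2⟩ := h.char_eq_of_measure_singleton_ne_zero hp₀ hp hq hne
    have e : walkPoly r₀ p₀ p q 1 (-t) = -(w + 2 * r₀ / p₀) := by
      simp only [walkPoly, ht]
      field_simp
      ring
    rw [e] at h1 h2
    set d := 2 * r₀ / p₀ with hd
    have hd0 : 0 < d := by positivity
    have e2 : d * (p * (2 * w + d) - t) = 0 := by linear_combination h1 - hchar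
    have e3 : p * (2 * w + d) - t = 0 := (mul_eq_zero.1 e2).resolve_left hd0.ne'
    nlinarith [mul_pos hp hw, mul_pos hp hd0, mul_pos hw hd0]
  have hsum : Summable fun j => walkWeight p₀ p q j * (w ^ j) ^ 2 := by
    rw [← summable_nat_add_iff 1]
    have e : ∀ j, walkWeight p₀ p q (j + 1) * (w ^ (j + 1)) ^ 2
        = p₀ * w ^ 2 / q * (p * w ^ 2 / q) ^ j := by
      intro j
      simp only [walkWeight, div_pow, mul_pow]
      field_simp
      ring
    simp only [e]
    exact (summable_geometric_of_lt_one (by positivity) ((div_lt_one hq).2 hwq)).mul_left _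
  set S := ∑' j, walkWeight p₀ p q j * (w ^ j) ^ 2 with hSdef
  have hterm : ∀ j, 0 ≤ walkWeight p₀ p q j * (w ^ j) ^ 2 := fun j =>
    mul_nonneg (walkWeight_pos hp₀ hp hq j).le (sq_nonneg _)
  have hS1 : 1 ≤ S := by
    calc (1 : ℝ) = walkWeight p₀ p q 0 * (w ^ 0) ^ 2 := by simp [walkWeight]
      _ ≤ S := hsum.le_tsum 0 fun j _ => hterm j
  -- Cauchy–Schwarz for `t^n = ∑ P^n_{0j} w^j` in the weights `π_j`, with `∫ x^(2n) dψ = ∑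
  -- (P^n_{0j})² / π_j`.
  have hCS : ∀ n, (t ^ n) ^ 2 ≤ S * ∫ x, (x ^ n) ^ 2 ∂ψ := by
    intro n
    have e1 : ∀ x, x ^ n = ∑ j ∈ Finset.range (n + 1), walkWeight p₀ p q j *
        (walkPow r₀ p₀ p q n 0 j / walkWeight p₀ p q j) * walkPoly r₀ p₀ p q j x := by
      intro x
      have := pow_mul_walkPoly_eq_sum (r₀ := r₀) (q := q) hp₀.ne' hp.ne' x n 0 (n + 1) (by omega)
      rw [show walkPoly r₀ p₀ p q 0 x = 1 by simp [walkPoly], mul_one] at this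
      rw [this]
      refine Finset.sum_congr rfl fun j _ => ?_
      rw [mul_div_cancel₀ _ (walkWeight_pos hp₀ hp hq j).ne']
    have e2 := h.integral_sum_sq (fun j => walkPow r₀ p₀ p q n 0 j / walkWeight p₀ p q j) (n + 1)
    simp only [← e1] at e2
    rw [e2, hexp]
    have e3 := Finset.sum_sq_le_sum_mul_sum_of_sq_le_mul (Finset.range (n + 1))
      (r := fun j => walkPow r₀ p₀ p q n 0 j * w ^ j)
      (f := fun j => walkWeight p₀ p q j * (w ^ j) ^ 2)
      (g := fun j => walkWeight p₀ p q j * (walkPow r₀ p₀ p q n 0 j / walkWeight p₀ p q j) ^ 2)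
      (fun j _ => hterm j)
      (fun j _ => mul_nonneg (walkWeight_pos hp₀ hp hq j).le (sq_nonneg _))
      (fun j _ => by
        have := (walkWeight_pos hp₀ hp hq j).ne'
        refine le_of_eq ?_
        field_simp)
    refine e3.trans (mul_le_mul_of_nonneg_right ?_ (Finset.sum_nonneg fun j _ =>
      mul_nonneg (walkWeight_pos hp₀ hp hq j).le (sq_nonneg _)))
    exact hsum.sum_le_tsum _ fun j _ => hterm j
  have hlim := (tendsto_integral_div_pow ht0 hst hneg).comp
    (tendsto_id.const_mul_atTop' (r := 2) two_pos)
  -- The integrals of `(x / t)^(2n)` are at least `1 / S` and tend to the mass at `t`.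
  have hge : 1 / S ≤ ψ.real {t} := by
    refine ge_of_tendsto' hlim fun n => ?_
    simp only [Function.comp_apply, id, div_pow, integral_div]
    rw [le_div_iff₀ (by positivity), div_mul_eq_mul_div, one_mul, div_le_iff₀ (by linarith),
      mul_comm 2 n]
    simp only [pow_mul]
    rw [mul_comm _ S]
    exact hCS n
  have hpos : 0 < ψ.real {t} := lt_of_lt_of_le (by positivity) hge
  have hne : ψ {t} ≠ 0 := fun h0 => by
    simp [Measure.real, h0] at hpos
  have heq : supportTop ψ = t := by
    refine le_antisymm hηt (not_lt.1 fun hlt => hne (measure_mono_null ?_ h.ae_le_supportTop))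
    rintro x rfl
    simpa using hlt
  rw [heq]
  exact ⟨hne, hneg⟩

end IsSpectralMeasure

/-! ### Comparison with the free walk: moment ratios in the absence of a root. -/

/-- The orthogonal polynomials of the free walk: `p V_{n+2} + q V_n = x V_{n+1}` with `V_0 = 1`
and `V_1 = x / p`. -/
noncomputable def freePoly (p q : ℝ) : ℕ → ℝ → ℝ
  | 0, _ => 1
  | 1, x => x / p
  | n + 2, x => (x * freePoly p q (n + 1) x - q * freePoly p q n x) / p

/-- The quadratic polynomial which relates the walk to the free walk. -/
noncomputable def bernsteinFactor (r₀ p₀ p q x : ℝ) : ℝ :=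
  (p - p₀) * x ^ 2 - (2 * p - p₀) * r₀ * x + (p * r₀ ^ 2 + p₀ ^ 2 * q)

theorem continuous_freePoly (p q : ℝ) : ∀ j, Continuous (freePoly p q j)
  | 0 => by simpa only [funext (freePoly.eq_1 p q)] using continuous_const
  | 1 => by
    rw [funext (freePoly.eq_2 p q)]
    fun_prop
  | j + 2 => by
    have h1 := continuous_freePoly p q (j + 1)
    have h2 := continuous_freePoly p q j
    rw [funext (freePoly.eq_3 p q · j)]
    fun_prop

theorem continuous_bernsteinFactor (r₀ p₀ p q : ℝ) : Continuous (bernsteinFactor r₀ p₀ p q) := by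
  unfold bernsteinFactor
  fun_prop

/-- Both sides obey the same recurrence in `n`, so two initial cases suffice. The right side
contains only `Q_j` with `j ≥ 1`, whose `ψ`-integrals vanish. -/
theorem bernsteinFactor_mul_freePoly {r₀ p₀ p q : ℝ} (hp₀ : p₀ ≠ 0) (hp : p ≠ 0) (x : ℝ) :
    ∀ n, bernsteinFactor r₀ p₀ p q x * freePoly p q (n + 1) x = p₀ * p *
      ((p - p₀) * walkPoly r₀ p₀ p q (n + 3) x - r₀ * walkPoly r₀ p₀ p q (n + 2) x
        + q * walkPoly r₀ p₀ p q (n + 1) x)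
  | 0 => by
    simp only [bernsteinFactor, freePoly, walkPoly]
    field_simp
    ring
  | 1 => by
    simp only [bernsteinFactor, freePoly, walkPoly]
    field_simp
    ring
  | n + 2 => by
    have h1 := bernsteinFactor_mul_freePoly (q := q) (r₀ := r₀) hp₀ hp x (n + 1)
    have h2 := bernsteinFactor_mul_freePoly (q := q) (r₀ := r₀) hp₀ hp x n
    have e1 := walkPoly_succ_row (r₀ := r₀) (p₀ := p₀) (q := q) hp x (n + 1)
    have e2 := walkPoly_succ_row (r₀ := r₀) (p₀ := p₀) (q := q) hp x (n + 2)
    have e3 := walkPoly_succ_row (r₀ := r₀) (p₀ := p₀) (q := q) hp x (n + 3)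
    have e4 : p * freePoly p q (n + 3) x = x * freePoly p q (n + 2) x - q * freePoly p q (n + 1) x := by
      rw [freePoly.eq_3]
      field_simp
    refine mul_left_cancel₀ hp ?_
    linear_combination bernsteinFactor r₀ p₀ p q x * e4 + x * h1 - q * h2
      - p₀ * p * ((p - p₀) * e3 - r₀ * e2 + q * e1)

namespace IsSpectralMeasure

variable {r₀ p₀ p q : ℝ} {ψ : Measure ℝ}

theorem integral_walkPoly_succ (h : IsSpectralMeasure r₀ p₀ p q ψ) (hp₀ : 0 < p₀) (hp : 0 < p)
    (hq : 0 < q) (j : ℕ) : ∫ x, walkPoly r₀ p₀ p q (j + 1) x ∂ψ = 0 := by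
  have h1 := h.orthogonal 0 (j + 1)
  rw [if_neg (by omega)] at h1
  have h2 := (mul_eq_zero.1 h1).resolve_left (walkWeight_pos hp₀ hp hq _).ne'
  simpa [walkPoly.eq_1] using h2

/-- The product of the spectral measure with the quadratic factor is symmetric. -/
theorem integral_pow_mul_freePoly (h : IsSpectralMeasure r₀ p₀ p q ψ) (hp₀ : 0 < p₀) (hp : 0 < p)
    (hq : 0 < q) (m : ℕ) : ∀ n, (m + n) % 2 = 1 →
      ∫ x, x ^ m * (bernsteinFactor r₀ p₀ p q x * freePoly p q n x) ∂ψ = 0 := by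
  have hcQ := continuous_walkPoly r₀ p₀ p q
  have hcV := continuous_freePoly p q
  have hcD := continuous_bernsteinFactor r₀ p₀ p q
  induction m with
  | zero =>
    rintro (_ | n) hn
    · omega
    · simp only [pow_zero, one_mul, bernsteinFactor_mul_freePoly hp₀.ne' hp.ne']
      have i1 := (h.integrable (hcQ (n + 1))).const_mul q
      have i2 := (h.integrable (hcQ (n + 2))).const_mul r₀
      have i3 := (h.integrable (hcQ (n + 3))).const_mul (p - p₀)
      have i4 : Integrable (fun x => (p - p₀) * walkPoly r₀ p₀ p q (n + 3) x
          - r₀ * walkPoly r₀ p₀ p q (n + 2) x) ψ := i3.sub i2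
      rw [integral_const_mul, integral_add i4 i1, integral_sub i3 i2]
      simp only [integral_const_mul, h.integral_walkPoly_succ hp₀ hp hq]
      ring
  | succ m ih =>
    rintro (_ | n) hn
    · have h1 := ih 1 (by omega)
      have e : ∀ x, x ^ (m + 1) * (bernsteinFactor r₀ p₀ p q x * freePoly p q 0 x)
          = p * (x ^ m * (bernsteinFactor r₀ p₀ p q x * freePoly p q 1 x)) := by
        intro x
        simp only [freePoly]
        field_simp
        ring
      simp only [e, integral_const_mul, h1, mul_zero]
    · have h1 := ih (n + 2) (by omega)
      have h2 := ih n (by omega)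
      have e : ∀ x, x ^ (m + 1) * (bernsteinFactor r₀ p₀ p q x * freePoly p q (n + 1) x)
          = p * (x ^ m * (bernsteinFactor r₀ p₀ p q x * freePoly p q (n + 2) x))
            + q * (x ^ m * (bernsteinFactor r₀ p₀ p q x * freePoly p q n x)) := by
        intro x
        rw [freePoly.eq_3]
        field_simp
        ring
      simp only [e]
      have i : ∀ n, Integrable
          (fun x => x ^ m * (bernsteinFactor r₀ p₀ p q x * freePoly p q n x)) ψ := by
        intro n
        refine h.integrable ?_
        have := hcV n
        fun_prop
      rw [integral_add ((i _).const_mul _) ((i _).const_mul _), integral_const_mul,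
        integral_const_mul, h1, h2, mul_zero, mul_zero, add_zero]

/-- The ratios of consecutive moments converge along even times. -/
theorem exists_tendsto_moment_ratio (h : IsSpectralMeasure r₀ p₀ p q ψ) (hr₀ : 0 < r₀)
    (hp₀ : 0 < p₀) (hp : 0 < p) (hq : 0 < q)
    (hG : ¬∃ w > 0, (p - p₀) * w ^ 2 - r₀ * w + q = 0 ∧ p * w ^ 2 < q) :
    ∃ L, Tendsto (fun m : ℕ => (∫ x, x ^ (2 * m + 1) ∂ψ) / ∫ x, x ^ (2 * m) ∂ψ) atTop (𝓝 L) := by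
  have := h.finite
  obtain ⟨hη, hs⟩ := h.supportTop_pos_and_ae_abs_le hr₀.le hp₀ hp hq
  have hIoi := h.measure_Ioi_ne_zero
  set η := supportTop ψ with hηdef
  set c := (p - p₀) * η ^ 2 + (p * r₀ ^ 2 + p₀ ^ 2 * q) with hc
  set d := (2 * p - p₀) * r₀ with hd
  have hμ := integral_pow_two_mul_pos hη hs hIoi
  -- The coefficients `d η²` and `c` are chosen to make this function vanish at `±η`; the term `D(x)
  -- x` integrates to zero against `x^(2m)`.
  have hlim := tendsto_integral_pow_mul_div hη hs hIoi
    (h := fun x => d * η ^ 2 - c * x + bernsteinFactor r₀ p₀ p q x * x)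
    (by have := continuous_bernsteinFactor r₀ p₀ p q; fun_prop)
    (by simp only [bernsteinFactor, hc, hd]; ring) (by simp only [bernsteinFactor, hc, hd]; ring)
  have hint : ∀ m : ℕ, ∫ x, x ^ (2 * m) * (d * η ^ 2 - c * x + bernsteinFactor r₀ p₀ p q x * x) ∂ψ
      = d * η ^ 2 * ∫ x, x ^ (2 * m) ∂ψ - c * ∫ x, x ^ (2 * m + 1) ∂ψ := by
    intro m
    have h0 := h.integral_pow_mul_freePoly hp₀ hp hq (2 * m + 1) 0 (by omega)
    have i1 : Integrable (fun x : ℝ => d * η ^ 2 * x ^ (2 * m)) ψ := h.integrable (by fun_prop)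
    have i2 : Integrable (fun x : ℝ => c * x ^ (2 * m + 1)) ψ := h.integrable (by fun_prop)
    have i3 : Integrable (fun x : ℝ => d * η ^ 2 * x ^ (2 * m) - c * x ^ (2 * m + 1)) ψ := i1.sub i2
    have i4 : Integrable (fun x : ℝ => x ^ (2 * m + 1) *
        (bernsteinFactor r₀ p₀ p q x * freePoly p q 0 x)) ψ := by
      have := continuous_bernsteinFactor r₀ p₀ p q
      have := continuous_freePoly p q 0
      exact h.integrable (by fun_prop)
    rw [← integral_const_mul, ← integral_const_mul, ← integral_sub i1 i2]
    refine Eq.trans ?_ ((integral_add i3 i4).trans (by rw [h0, add_zero]))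
    refine integral_congr_ae (Eventually.of_forall fun x => ?_)
    simp only [freePoly]
    ring
  have hlim' : Tendsto (fun m : ℕ =>
      c * ((∫ x, x ^ (2 * m + 1) ∂ψ) / ∫ x, x ^ (2 * m) ∂ψ)) atTop (𝓝 (d * η ^ 2)) := by
    have h1 := hlim.const_sub (d * η ^ 2)
    rw [sub_zero] at h1
    refine h1.congr fun m => ?_
    have := (hμ m).ne'
    rw [hint]
    field_simp
    ring
  -- If `c = 0`, then `d = 0`, so `p₀ = 2p`, and the excluded root exists.
  have hc0 : c ≠ 0 := by
    intro hc0
    simp only [hc0, zero_mul] at hlim'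
    have h1 : d * η ^ 2 = 0 := (tendsto_nhds_unique tendsto_const_nhds hlim').symm
    have h2 : d = 0 := (mul_eq_zero.1 h1).resolve_right (pow_pos hη 2).ne'
    have h3 : 2 * p - p₀ = 0 := (mul_eq_zero.1 h2).resolve_right hr₀.ne'
    exact hG (exists_pos_root_of_eq_two_mul hr₀ hp hq (by linarith))
  refine ⟨c⁻¹ * (d * η ^ 2), (hlim'.const_mul c⁻¹).congr fun m => ?_⟩
  rw [inv_mul_cancel_left₀ hc0]

end IsSpectralMeasure

/-! ### Ratio limits for the transition probabilities. -/

theorem eventually_atTop_of_even_odd {P : ℕ → Prop} (h0 : ∀ᶠ m in atTop, P (2 * m))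
    (h1 : ∀ᶠ m in atTop, P (2 * m + 1)) : ∀ᶠ n in atTop, P n := by
  obtain ⟨a, ha⟩ := eventually_atTop.1 h0
  obtain ⟨b, hb⟩ := eventually_atTop.1 h1
  refine eventually_atTop.2 ⟨2 * (a + b), fun n hn => ?_⟩
  obtain ⟨m, rfl | rfl⟩ := n.even_or_odd'
  · exact ha m (by omega)
  · exact hb m (by omega)

theorem tendsto_atTop_of_even_odd {f : ℕ → ℝ} {l : Filter ℝ}
    (h0 : Tendsto (fun m => f (2 * m)) atTop l) (h1 : Tendsto (fun m => f (2 * m + 1)) atTop l) :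
    Tendsto f atTop l := fun _ hs => eventually_atTop_of_even_odd (h0 hs) (h1 hs)

theorem walkPoly_neg {p₀ p q : ℝ} (x : ℝ) :
    ∀ j, walkPoly 0 p₀ p q j (-x) = (-1) ^ j * walkPoly 0 p₀ p q j x
  | 0 => by simp [walkPoly]
  | 1 => by
    simp only [walkPoly]
    ring
  | j + 2 => by
    rw [walkPoly.eq_3, walkPoly.eq_3, walkPoly_neg x (j + 1), walkPoly_neg x j]
    ring

namespace IsSpectralMeasure

variable {r₀ p₀ p q : ℝ} {ψ : Measure ℝ}

theorem walkPow_even_antitone (h : IsSpectralMeasure r₀ p₀ p q ψ) (hp₀ : 0 < p₀) (hp : 0 < p)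
    {a b : ℕ} (hab : a ≤ b) : walkPow r₀ p₀ p q (2 * b) 0 0 ≤ walkPow r₀ p₀ p q (2 * a) 0 0 := by
  rw [← h.integral_pow hp₀ hp, ← h.integral_pow hp₀ hp]
  refine integral_mono_ae (h.integrable (by fun_prop)) (h.integrable (by fun_prop)) ?_
  filter_upwards [h.ae_mem_Icc] with x hx
  simp only [pow_mul]
  exact pow_le_pow_of_le_one (sq_nonneg x) ((sq_le_one_iff_abs_le_one x).2 (abs_le.2 hx)) hab

/-- Paths through `0` serve when the parities agree; otherwise one stay at `0`, of weight `r₀ > 0`,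
corrects the parity. Even return probabilities decrease, which absorbs the time shift. -/
theorem eventually_mul_walkPow_le (h : IsSpectralMeasure r₀ p₀ p q ψ) (hr₀ : 0 ≤ r₀) (hp₀ : 0 < p₀)
    (hp : 0 < p) (hq : 0 < q) {e k l : ℕ} (he : e < 2) (hpar : 0 < r₀ ∨ e = (k + l) % 2) :
    ∃ c > 0, ∀ᶠ m in atTop,
      c * walkPow r₀ p₀ p q (2 * m) 0 0 ≤ walkPow r₀ p₀ p q (2 * m + e) k l := by
  obtain ⟨c, hc, hle⟩ := walkPow_lower_bound h hr₀ hp₀ hp hq k l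
  by_cases hpe : e = (k + l) % 2
  · refine ⟨c, hc, eventually_atTop.2 ⟨k + l, fun m hm => ?_⟩⟩
    have h1 := hle (2 * (m - (k + l) / 2))
    rw [show 2 * (m - (k + l) / 2) + (k + l) = 2 * m + e by omega] at h1
    refine le_trans (mul_le_mul_of_nonneg_left ?_ hc.le) h1
    exact h.walkPow_even_antitone hp₀ hp (Nat.sub_le _ _)
  · have hr := hpar.resolve_right hpe
    refine ⟨c * r₀, by positivity, eventually_atTop.2 ⟨k + l + 1, fun m hm => ?_⟩⟩
    have h1 := hle (2 * (m + e - 1 - (k + l) / 2) + 1)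
    rw [show 2 * (m + e - 1 - (k + l) / 2) + 1 + (k + l) = 2 * m + e by omega] at h1
    have h2 := walkMatrix_mul_walkPow_le hr₀ hp₀.le hp.le hq.le
      (2 * (m + e - 1 - (k + l) / 2)) 0 0 0 (by omega)
    rw [show walkMatrix r₀ p₀ p q 0 0 = r₀ by simp [walkMatrix]] at h2
    refine le_trans ?_ h1
    rw [mul_assoc]
    refine mul_le_mul_of_nonneg_left (le_trans (mul_le_mul_of_nonneg_left ?_ hr.le) h2) hc.le
    exact h.walkPow_even_antitone hp₀ hp (by omega)

/-- The limit of `∫ x^(2m) h dψ / ∫ x^(2m) dψ`, given the limit `L` of the moment ratios. -/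
noncomputable def endpointValue (η L : ℝ) (h : ℝ → ℝ) : ℝ :=
  (h η + h (-η)) / 2 + (h η - h (-η)) / (2 * η) * L

theorem tendsto_walkPow_div (h : IsSpectralMeasure r₀ p₀ p q ψ) (hr₀ : 0 ≤ r₀) (hp₀ : 0 < p₀)
    (hp : 0 < p) (hq : 0 < q) {L : ℝ}
    (hL : Tendsto (fun m : ℕ => (∫ x, x ^ (2 * m + 1) ∂ψ) / ∫ x, x ^ (2 * m) ∂ψ) atTop (𝓝 L))
    (e i j : ℕ) :
    Tendsto (fun m : ℕ => walkPow r₀ p₀ p q (2 * m + e) i j / walkPow r₀ p₀ p q (2 * m) 0 0) atTop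
      (𝓝 (walkWeight p₀ p q j * endpointValue (supportTop ψ) L
        fun x => x ^ e * (walkPoly r₀ p₀ p q i x * walkPoly r₀ p₀ p q j x))) := by
  have := h.finite
  obtain ⟨hη, hs⟩ := h.supportTop_pos_and_ae_abs_le hr₀ hp₀ hp hq
  have hci := continuous_walkPoly r₀ p₀ p q i
  have hcj := continuous_walkPoly r₀ p₀ p q j
  have h1 := (tendsto_integral_pow_mul_div_of_tendsto hη hs h.measure_Ioi_ne_zero hL
    (h := fun x => x ^ e * (walkPoly r₀ p₀ p q i x * walkPoly r₀ p₀ p q j x))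
    (by fun_prop)).const_mul (walkWeight p₀ p q j)
  refine h1.congr fun m => ?_
  rw [h.walkPow_eq hp₀ hp, ← h.integral_pow hp₀ hp, mul_div_assoc]
  simp only [pow_add, mul_assoc]

/-- The limit inherits the lower bound `c > 0`. This is also the source of `Q_k(η) Q_l(η) ≠ 0`. -/
theorem endpointValue_pos (h : IsSpectralMeasure r₀ p₀ p q ψ) (hr₀ : 0 ≤ r₀) (hp₀ : 0 < p₀)
    (hp : 0 < p) (hq : 0 < q) {L : ℝ}
    (hL : Tendsto (fun m : ℕ => (∫ x, x ^ (2 * m + 1) ∂ψ) / ∫ x, x ^ (2 * m) ∂ψ) atTop (𝓝 L))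
    {e k l : ℕ} (he : e < 2) (hpar : 0 < r₀ ∨ e = (k + l) % 2) :
    0 < endpointValue (supportTop ψ) L
        fun x => x ^ e * (walkPoly r₀ p₀ p q k x * walkPoly r₀ p₀ p q l x) := by
  obtain ⟨c, hc, hle⟩ := h.eventually_mul_walkPow_le hr₀ hp₀ hp hq he hpar
  refine pos_of_mul_pos_right (hc.trans_le ?_) (walkWeight_pos hp₀ hp hq l).le
  refine ge_of_tendsto (h.tendsto_walkPow_div hr₀ hp₀ hp hq hL e k l) ?_
  filter_upwards [hle] with m hm
  exact (le_div_iff₀ (walkPow_two_mul_pos hr₀ hp₀ hp hq m)).2 hm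

theorem eventually_walkPow_pos (h : IsSpectralMeasure r₀ p₀ p q ψ) (hr₀ : 0 ≤ r₀) (hp₀ : 0 < p₀)
    (hp : 0 < p) (hq : 0 < q) {e k l : ℕ} (he : e < 2) (hpar : 0 < r₀ ∨ e = (k + l) % 2) :
    ∀ᶠ m in atTop, walkPow r₀ p₀ p q (2 * m + e) k l ≠ 0 := by
  obtain ⟨c, hc, hle⟩ := h.eventually_mul_walkPow_le hr₀ hp₀ hp hq he hpar
  filter_upwards [hle] with m hm
  exact ((mul_pos hc (walkPow_two_mul_pos hr₀ hp₀ hp hq m)).trans_le hm).ne'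

theorem tendsto_walkPow_ratio (h : IsSpectralMeasure r₀ p₀ p q ψ) (hr₀ : 0 ≤ r₀) (hp₀ : 0 < p₀)
    (hp : 0 < p) (hq : 0 < q) {L : ℝ}
    (hL : Tendsto (fun m : ℕ => (∫ x, x ^ (2 * m + 1) ∂ψ) / ∫ x, x ^ (2 * m) ∂ψ) atTop (𝓝 L))
    {e k l : ℕ} (he : e < 2) (hpar : 0 < r₀ ∨ e = (k + l) % 2) (i j : ℕ) :
    Tendsto (fun m : ℕ =>
        walkPow r₀ p₀ p q (2 * m + e) i j / walkPow r₀ p₀ p q (2 * m + e) k l) atTop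
      (𝓝 (walkWeight p₀ p q j / walkWeight p₀ p q l * (endpointValue (supportTop ψ) L
          (fun x => x ^ e * (walkPoly r₀ p₀ p q i x * walkPoly r₀ p₀ p q j x)) /
        endpointValue (supportTop ψ) L
          fun x => x ^ e * (walkPoly r₀ p₀ p q k x * walkPoly r₀ p₀ p q l x)))) := by
  have hpos := h.endpointValue_pos hr₀ hp₀ hp hq hL he hpar
  have h1 := (h.tendsto_walkPow_div hr₀ hp₀ hp hq hL e i j).div
    (h.tendsto_walkPow_div hr₀ hp₀ hp hq hL e k l)
    (mul_pos (walkWeight_pos hp₀ hp hq l) hpos).ne'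
  rw [mul_div_mul_comm] at h1
  refine h1.congr fun m => ?_
  exact div_div_div_cancel_right₀ (walkPow_two_mul_pos hr₀ hp₀ hp hq m).ne' _ _

/-- After scaling by `η`, consecutive moments both tend to the mass at `η`, which is not zero. -/
theorem tendsto_moment_ratio_of_root (h : IsSpectralMeasure r₀ p₀ p q ψ) (hr₀ : 0 < r₀)
    (hp₀ : 0 < p₀) (hp : 0 < p) (hq : 0 < q)
    (hG : ∃ w > 0, (p - p₀) * w ^ 2 - r₀ * w + q = 0 ∧ p * w ^ 2 < q) :
    Tendsto (fun m : ℕ => (∫ x, x ^ (2 * m + 1) ∂ψ) / ∫ x, x ^ (2 * m) ∂ψ) atTop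
      (𝓝 (supportTop ψ)) := by
  have := h.finite
  obtain ⟨w, hw, hG, hwq⟩ := hG
  obtain ⟨h1, h2⟩ := h.point_mass_of_root hr₀ hp₀ hp hq hw hG hwq
  obtain ⟨hη, hs⟩ := h.supportTop_pos_and_ae_abs_le hr₀.le hp₀ hp hq
  have hlim := tendsto_integral_div_pow hη hs h2
  have hne : ψ.real {supportTop ψ} ≠ 0 := (ENNReal.toReal_pos h1 (measure_ne_top _ _)).ne'
  have h2m : Tendsto (fun m : ℕ => 2 * m) atTop atTop :=
    tendsto_id.const_mul_atTop' (r := 2) two_pos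
  have h3 := ((hlim.comp ((tendsto_add_atTop_nat 1).comp h2m)).div (hlim.comp h2m) hne).const_mul
    (supportTop ψ)
  rw [div_self hne, mul_one] at h3
  refine h3.congr fun m => ?_
  simp only [Pi.div_apply, Function.comp_apply, div_pow, integral_div]
  field_simp
  ring

theorem exists_root_of_point_mass (h : IsSpectralMeasure r₀ p₀ p q ψ) (hr₀ : 0 ≤ r₀)
    (hp₀ : 0 < p₀) (hp : 0 < p) (hq : 0 < q) {x : ℝ} (hx : ψ {x} ≠ 0) :
    ∃ w > 0, (p - p₀) * w ^ 2 - r₀ * w + q = 0 ∧ p * w ^ 2 < q := by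
  obtain ⟨h1, h2⟩ := h.char_eq_of_measure_singleton_ne_zero hp₀ hp hq hx
  refine exists_pos_root hr₀ hp hq ?_ h2
  -- Eliminating `x = r₀ + p₀ w` turns the characteristic equation into one for `w` alone.
  have h3 : p₀ * walkPoly r₀ p₀ p q 1 x = x - r₀ := by
    simp only [walkPoly]
    field_simp
  linear_combination h1 - walkPoly r₀ p₀ p q 1 x * h3

theorem endpointValue_self {η : ℝ} (hη : η ≠ 0) (f : ℝ → ℝ) : endpointValue η η f = f η := by
  unfold endpointValue
  field_simp
  ring

theorem endpointValue_zero_of_even {η : ℝ} {f : ℝ → ℝ} (hf : f (-η) = f η) :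
    endpointValue η 0 f = f η := by
  unfold endpointValue
  rw [hf]
  ring

end IsSpectralMeasure

open IsSpectralMeasure

theorem mainTheorem4 (r₀ p₀ p q : ℝ) (hr₀ : 0 ≤ r₀) (hp₀ : 0 < p₀) (hsum : r₀ + p₀ ≤ 1)
    (hp : 0 < p) (hq : 0 < q) (hpq : p + q = 1) :
    (∃! ψ : Measure ℝ, IsSpectralMeasure r₀ p₀ p q ψ) ∧
    ∀ ψ : Measure ℝ, IsSpectralMeasure r₀ p₀ p q ψ →
      -- non-symmetric case with a point mass of nonzero weight: the ratio limit exists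
      (r₀ ≠ 0 → (∃ x : ℝ, ψ {x} ≠ 0) → ∀ i j k l : ℕ,
        (∀ᶠ n in atTop, walkPow r₀ p₀ p q n k l ≠ 0) ∧
        walkPoly r₀ p₀ p q k (supportTop ψ) * walkPoly r₀ p₀ p q l (supportTop ψ) ≠ 0 ∧
        Tendsto (fun n : ℕ => walkPow r₀ p₀ p q n i j / walkPow r₀ p₀ p q n k l) atTop
          (𝓝 (ratioValue r₀ p₀ p q i j k l (supportTop ψ)))) ∧
      -- non-symmetric case, any parameters: the limits along even and along odd times exist
      (r₀ ≠ 0 → ∀ i j k l : ℕ,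
        (∀ᶠ n in atTop, walkPow r₀ p₀ p q n k l ≠ 0) ∧
        (∃ L : ℝ, Tendsto (fun m : ℕ =>
          walkPow r₀ p₀ p q (2 * m) i j / walkPow r₀ p₀ p q (2 * m) k l) atTop (𝓝 L)) ∧
        (∃ L : ℝ, Tendsto (fun m : ℕ =>
          walkPow r₀ p₀ p q (2 * m + 1) i j / walkPow r₀ p₀ p q (2 * m + 1) k l) atTop (𝓝 L))) ∧
      -- symmetric case: `P^n_{kl}` vanishes unless `n` and `k + l` have the same parity,
      -- and the limit is taken along the times `n` of that parity
      (r₀ = 0 → ∀ i j k l : ℕ,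
        (∀ n : ℕ, n % 2 ≠ (k + l) % 2 → walkPow r₀ p₀ p q n k l = 0) ∧
        (∀ᶠ m in atTop, walkPow r₀ p₀ p q (2 * m + (k + l) % 2) k l ≠ 0) ∧
        walkPoly r₀ p₀ p q k (supportTop ψ) * walkPoly r₀ p₀ p q l (supportTop ψ) ≠ 0 ∧
        Tendsto (fun m : ℕ => walkPow r₀ p₀ p q (2 * m + (k + l) % 2) i j /
            walkPow r₀ p₀ p q (2 * m + (k + l) % 2) k l) atTop
          (𝓝 (if (i + j) % 2 = (k + l) % 2 then
            ratioValue r₀ p₀ p q i j k l (supportTop ψ) else 0))) := by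
  obtain ⟨ψ₀, hψ₀⟩ := exists_isSpectralMeasure hr₀ hp₀ hsum hp hq hpq
  refine ⟨⟨ψ₀, hψ₀, fun ψ hψ => hψ.unique hψ₀ hp₀ hp⟩, fun ψ h => ?_⟩
  obtain ⟨hη, -⟩ := h.supportTop_pos_and_ae_abs_le hr₀ hp₀ hp hq
  have hev : 0 < r₀ → ∀ k l, ∀ᶠ n in atTop, walkPow r₀ p₀ p q n k l ≠ 0 := fun hr k l =>
    eventually_atTop_of_even_odd
      (h.eventually_walkPow_pos hr₀ hp₀ hp hq (e := 0) two_pos (Or.inl hr))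
      (h.eventually_walkPow_pos hr₀ hp₀ hp hq (e := 1) one_lt_two (Or.inl hr))
  refine ⟨fun hr hmass i j k l => ?_, fun hr i j k l => ?_, fun hr i j k l => ?_⟩
  · replace hr := lt_of_le_of_ne hr₀ hr.symm
    obtain ⟨x, hx⟩ := hmass
    have hL := h.tendsto_moment_ratio_of_root hr hp₀ hp hq
      (h.exists_root_of_point_mass hr₀ hp₀ hp hq hx)
    have hlim : ∀ e < 2, Tendsto (fun m : ℕ => walkPow r₀ p₀ p q (2 * m + e) i j /
        walkPow r₀ p₀ p q (2 * m + e) k l) atTop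
        (𝓝 (ratioValue r₀ p₀ p q i j k l (supportTop ψ))) := by
      intro e he
      -- With `L = η` only the value at `η` survives, and `η^e` cancels: both parities have the same
      -- limit.
      have h1 := h.tendsto_walkPow_ratio hr₀ hp₀ hp hq hL he (k := k) (l := l) (Or.inl hr) i j
      rwa [endpointValue_self hη.ne', endpointValue_self hη.ne',
        mul_div_mul_left _ _ (pow_pos hη e).ne'] at h1
    have hpos := h.endpointValue_pos hr₀ hp₀ hp hq hL (e := 0) (k := k) (l := l) two_pos (Or.inl hr)
    rw [endpointValue_self hη.ne', pow_zero, one_mul] at hpos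
    exact ⟨hev hr k l, hpos.ne', tendsto_atTop_of_even_odd (hlim 0 two_pos) (hlim 1 one_lt_two)⟩
  · replace hr := lt_of_le_of_ne hr₀ hr.symm
    obtain ⟨L, hL⟩ : ∃ L, Tendsto (fun m : ℕ =>
        (∫ x, x ^ (2 * m + 1) ∂ψ) / ∫ x, x ^ (2 * m) ∂ψ) atTop (𝓝 L) := by
      by_cases hG : ∃ w > 0, (p - p₀) * w ^ 2 - r₀ * w + q = 0 ∧ p * w ^ 2 < q
      · exact ⟨_, h.tendsto_moment_ratio_of_root hr hp₀ hp hq hG⟩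
      · exact h.exists_tendsto_moment_ratio hr hp₀ hp hq hG
    exact ⟨hev hr k l,
      ⟨_, h.tendsto_walkPow_ratio hr₀ hp₀ hp hq hL (e := 0) two_pos (Or.inl hr) i j⟩,
      ⟨_, h.tendsto_walkPow_ratio hr₀ hp₀ hp hq hL (e := 1) one_lt_two (Or.inl hr) i j⟩⟩
  · subst hr
    have he : (k + l) % 2 < 2 := Nat.mod_lt _ two_pos
    have hL : Tendsto (fun m : ℕ => (∫ x, x ^ (2 * m + 1) ∂ψ) / ∫ x, x ^ (2 * m) ∂ψ) atTop
        (𝓝 0) := by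
      refine tendsto_const_nhds.congr fun m => ?_
      rw [h.integral_pow hp₀ hp, walkPow_eq_zero_of_odd _ _ _ (by omega), zero_div]
    -- With `L = 0` the limit averages the values at `±η`, which agree since the integrand is even.
    have heven : ∀ i j, (i + j) % 2 = (k + l) % 2 → endpointValue (supportTop ψ) 0
        (fun x => x ^ ((k + l) % 2) * (walkPoly 0 p₀ p q i x * walkPoly 0 p₀ p q j x))
        = supportTop ψ ^ ((k + l) % 2) *
          (walkPoly 0 p₀ p q i (supportTop ψ) * walkPoly 0 p₀ p q j (supportTop ψ)) := by
      intro i j hij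
      refine endpointValue_zero_of_even ?_
      have hs : ((-1 : ℝ)) ^ ((k + l) % 2) * ((-1) ^ i * (-1) ^ j) = 1 := by
        rw [← pow_add, ← pow_add]
        exact Even.neg_one_pow (Nat.even_iff.2 (by omega))
      rw [walkPoly_neg, walkPoly_neg, neg_pow]
      linear_combination supportTop ψ ^ ((k + l) % 2) * (walkPoly 0 p₀ p q i (supportTop ψ)
        * walkPoly 0 p₀ p q j (supportTop ψ)) * hs
    have hpos := h.endpointValue_pos hr₀ hp₀ hp hq hL (k := k) (l := l) he (Or.inr rfl)
    rw [heven k l rfl] at hpos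
    refine ⟨fun n hn => walkPow_eq_zero_of_odd n k l hn,
      h.eventually_walkPow_pos hr₀ hp₀ hp hq he (Or.inr rfl),
      (pos_of_mul_pos_right hpos (pow_pos hη _).le).ne', ?_⟩
    split_ifs with hij
    · have h1 := h.tendsto_walkPow_ratio hr₀ hp₀ hp hq hL (k := k) (l := l) he (Or.inr rfl) i j
      rwa [heven k l rfl, heven i j hij, mul_div_mul_left _ _ (pow_pos hη _).ne'] at h1
    · refine tendsto_const_nhds.congr fun m => ?_
      rw [walkPow_eq_zero_of_odd _ i j (by omega), zero_div]
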